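/- Let $\Gamma$ be a finite group with set of conjugacy classes $\Gamma_*$; write $c$ also for the sum of the elements of a class $c$ in a group algebra. Let $\mathfrak g = Z(\mathbb{Q}\Gamma)$, viewed as an (abelian) Lie algebra with canonical map $\iota:\mathfrak g\to\mathcal U(\mathfrak g)$ to its universal enveloping algebra, and let $T$ be the coefficientwise extension of $\iota$ to formal power series in commuting variables $x_c$ ($c\in\Gamma_*$). Define elements $B_{\mathbf N}\in\mathcal U(\mathfrak g)$, for $\mathbf N\in\mathbb{Z}_{\ge 0}^{\Gamma_*}$, by $$\exp\Big(T\Big(\log\Big(1+\sum_{c\in\Gamma_*} c\,x_c\Big)\Big)\Big)=\sum_{\mathbf N} B_{\mathbf N}\,x^{\mathbf N},$$ where the logarithm is computed in the associative algebra $\mathfrak g$. Let $\mathcal R_\Gamma$ be the $\mathbb{Z}$-span of the $B_{\mathbf N}$ in $\mathcal U(\mathfrak g)$. It contains the elements $T(c)=\iota(c)$, $c\in\Gamma_*$. Let $p$ be a prime and $\mathbb{F}$ an algebraically closed field of characteristic $p$. Let $C_u$ run over the blocks of $\mathbb{F}\Gamma$ (the indecomposable two-sided ideals that are direct summands of $\mathbb{F}\Gamma$),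 and let $\omega^u_c\in\mathbb{F}$ be the value of the central character of $C_u$ at the class sum $c$, i.e. the scalar by which $c$ acts on any simple $\mathbb{F}\Gamma$-module belonging to $C_u$. For $t\in\mathbb{Z}_p$ and a power series $f$ over $\mathbb{F}$ without constant term, let $(1+f)^t=\sum_{r\ge 0}\binom{t}{r}f^r$, where $p$-adic integers are mapped to $\mathbb{F}$ by $\mathbb{Z}_p\to\mathbb{Z}_p/(p)=\mathbb{Z}/p\mathbb{Z}\subseteq\mathbb{F}$. **Theorem.** $\mathcal R_\Gamma$ is a subring of $\mathcal U(\mathfrak g)$, and there is a bijection $(t_u)_u\mapsto\varphi_{(t_u)}$ from the set of tuples of $p$-adic integers, one for each block $C_u$ of $\mathbb{F}\Gamma$, to the set of (unital) ring homomorphisms $\mathcal R_\Gamma\to\mathbb{F}$, such that for every tuple $(t_u)$ the homomorphism $\varphi=\varphi_{(t_u)}$ satisfies $$\varphi(T(c))=\sum_u\omega^u_c\,t_u\quad(c\in\Gamma_*),\qquad \sum_{\mathbf N}\varphi(B_{\mathbf N})\,x^{\mathbf N}=\prod_u\Big(1+\sum_{c\in\Gamma_*}\omega^u_c\,x_c\Big)^{t_u}$$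 (with $t_u$ mapped to $\mathbb{F}$ in the first formula). The second formula determines $\varphi$. -/

import Mathlib

noncomputable section

open scoped Classical

namespace WeightedIVP

/-! ### Centres of group algebras and class sums -/

section Centre

variable (k : Type*) [CommRing k] (Γ : Type*) [Group Γ]

/-- The centre `Z(kΓ)` of the group algebra. -/
abbrev GroupCenter : Type _ := Subalgebra.center k (MonoidAlgebra k Γ)

variable {Γ} [Fintype Γ]

/-- The sum of the elements of a conjugacy class, in the group algebra. -/
def rawClassSum (c : ConjClasses Γ) : MonoidAlgebra k Γ :=
  ∑ g : Γ with ConjClasses.mk g = c, MonoidAlgebra.of k Γ g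

theorem rawClassSum_comm (c : ConjClasses Γ) (x : MonoidAlgebra k Γ) :
    x * rawClassSum k c = rawClassSum k c * x := by
  induction x using MonoidAlgebra.induction_on with
  | of h =>
    simp only [rawClassSum, Finset.mul_sum, Finset.sum_mul, ← map_mul]
    refine Finset.sum_bij (fun g _ => h * g * h⁻¹) ?_ ?_ ?_ ?_
    · intro g hg
      simp only [Finset.mem_filter, Finset.mem_univ, true_and] at hg ⊢
      rw [← hg, ConjClasses.mk_eq_mk_iff_isConj, isConj_comm]
      exact isConj_iff.2 ⟨h, rfl⟩
    · intro a _ b _ hab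
      simpa using hab
    · intro b hb
      refine ⟨h⁻¹ * b * h, ?_, by group⟩
      simp only [Finset.mem_filter, Finset.mem_univ, true_and] at hb ⊢
      rw [← hb, ConjClasses.mk_eq_mk_iff_isConj, isConj_comm]
      exact isConj_iff.2 ⟨h⁻¹, by simp⟩
    · intro g _
      simp
  | add x y hx hy => rw [add_mul, mul_add, hx, hy]
  | smul r x hx => rw [smul_mul_assoc, mul_smul_comm, hx]

/-- The class sum of `c`, as an element of the centre of `kΓ`. -/
def classSum (c : ConjClasses Γ) : GroupCenter k Γ :=
  ⟨rawClassSum k c, Subalgebra.mem_center_iff.2 (rawClassSum_comm k c)⟩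

end Centre

/-! ### Formal exponential, logarithm and powers

For a power series `f` without constant term, `f ^ k` has no terms of degree less than `k`, so that
only the summands `k ≤ |N|` of the usual series contribute to the coefficient of `x ^ N`. -/

section Formal

variable {σ A : Type*} [Ring A] [Algebra ℚ A]

/-- `exp f = ∑ₖ f ^ k / k!`, for `f` without constant term. -/
def formalExp (f : MvPowerSeries σ A) : MvPowerSeries σ A := fun N =>
  ∑ k ∈ Finset.range (N.degree + 1), ((k.factorial : ℚ)⁻¹) • MvPowerSeries.coeff N (f ^ k)

/-- `log (1 + f) = ∑_{k ≥ 1} (-1) ^ (k - 1) f ^ k / k`, for `f` without constant term. -/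
def formalLogOneAdd (f : MvPowerSeries σ A) : MvPowerSeries σ A := fun N =>
  ∑ k ∈ Finset.Icc 1 N.degree, ((-1 : ℚ) ^ (k + 1) / k) • MvPowerSeries.coeff N (f ^ k)

end Formal

section Power

variable (p : ℕ) [Fact p.Prime] (F : Type*) [Field F] [CharP F p]

/-- The canonical map `ℤ_p → ℤ/p ⊆ F` to a field of characteristic `p`. -/
def padicToField : ℤ_[p] →+* F := (ZMod.castHom (dvd_refl p) F).comp PadicInt.toZMod

variable {p F} {σ : Type*}

/-- `(1 + f) ^ t = ∑ᵣ (t choose r) f ^ r` for a `p`-adic integer `t` and a power series `f` over `F`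
without constant term. -/
def oneAddPow (f : MvPowerSeries σ F) (t : ℤ_[p]) : MvPowerSeries σ F := fun N =>
  ∑ r ∈ Finset.range (N.degree + 1),
    padicToField p F (Ring.choose t r) * MvPowerSeries.coeff N (f ^ r)

end Power

/-! ### The ring of `Γ_*`-weighted integer-valued polynomials -/

section RGamma

attribute [local instance 100] LieRing.ofAssociativeRing

variable (Γ : Type*) [Group Γ]

/-- The universal enveloping algebra of `𝔤 = Z(ℚΓ)` with its commutator bracket. -/
abbrev Env : Type _ := UniversalEnvelopingAlgebra ℚ (GroupCenter ℚ Γ)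

/-- The canonical linear map `𝔤 → U(𝔤)`. -/
def envι : GroupCenter ℚ Γ →ₗ[ℚ] Env Γ :=
  (UniversalEnvelopingAlgebra.ι ℚ : GroupCenter ℚ Γ →ₗ⁅ℚ⁆ Env Γ)

/-- The coefficientwise extension of `𝔤 → U(𝔤)` to power series in the variables `x_c`. -/
def seriesT (f : MvPowerSeries (ConjClasses Γ) (GroupCenter ℚ Γ)) :
    MvPowerSeries (ConjClasses Γ) (Env Γ) := fun N => envι Γ (MvPowerSeries.coeff N f)

variable [Fintype Γ]

/-- The linear form `∑_c c x_c` with coefficients in `𝔤`. -/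
def genericElt : MvPowerSeries (ConjClasses Γ) (GroupCenter ℚ Γ) :=
  ∑ c : ConjClasses Γ, MvPowerSeries.monomial (Finsupp.single c 1) (classSum ℚ c)

/-- `Ω = exp (T (log (1 + ∑_c c x_c)))`. -/
def omega : MvPowerSeries (ConjClasses Γ) (Env Γ) :=
  formalExp (seriesT Γ (formalLogOneAdd (genericElt Γ)))

variable {Γ} in
/-- The coefficient `B_N` of `x ^ N` in `Ω`. -/
def coeffB (N : ConjClasses Γ →₀ ℕ) : Env Γ := MvPowerSeries.coeff N (omega Γ)

/-- The `ℤ`-span of the `B_N`. -/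
def rGammaSpan : Submodule ℤ (Env Γ) := Submodule.span ℤ (Set.range (coeffB (Γ := Γ)))

/-- The ring `R_Γ`: the subring of `U(𝔤)` generated by the `ℤ`-span of the `B_N`. (It is in fact equal to
that span: the equality is part of the theorem, not of this definition.) -/
def RGamma : Subring (Env Γ) := Subring.closure (rGammaSpan Γ : Set (Env Γ))

variable {Γ}

/-- `B_N` as an element of `R_Γ`. -/
def elemB (N : ConjClasses Γ →₀ ℕ) : RGamma Γ :=
  ⟨coeffB N, Subring.subset_closure (Submodule.subset_span ⟨N, rfl⟩)⟩

theorem coeff_genericElt (c : ConjClasses Γ) :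
    MvPowerSeries.coeff (Finsupp.single c 1) (genericElt Γ) = classSum ℚ c := by
  rw [genericElt, map_sum, Finset.sum_eq_single c]
  · simp
  · intro b _ hb
    rw [MvPowerSeries.coeff_monomial, if_neg]
    intro h
    exact hb (Finsupp.single_left_injective one_ne_zero h).symm
  · simp

theorem coeffB_single (c : ConjClasses Γ) :
    coeffB (Finsupp.single c 1) = envι Γ (classSum ℚ c) := by
  have hne : (Finsupp.single c 1 : ConjClasses Γ →₀ ℕ) ≠ 0 := by simp
  have h1 : MvPowerSeries.coeff (Finsupp.single c 1) (formalLogOneAdd (genericElt Γ))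
      = classSum ℚ c := by
    rw [← coeff_genericElt]
    simp [formalLogOneAdd, MvPowerSeries.coeff_apply]
  have h2 : MvPowerSeries.coeff (Finsupp.single c 1)
      (seriesT Γ (formalLogOneAdd (genericElt Γ))) = envι Γ (classSum ℚ c) := by
    rw [← h1]; rfl
  rw [← h2]
  have h3 : MvPowerSeries.coeff (Finsupp.single c 1)
      (1 : MvPowerSeries (ConjClasses Γ) (Env Γ)) = 0 := by
    rw [MvPowerSeries.coeff_one, if_neg hne]
  simp only [coeffB, omega]
  rw [MvPowerSeries.coeff_apply (formalExp _)]
  simp [formalExp, Finset.sum_range_succ, h3]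

/-- The element `T(c)` of `R_Γ` for a class sum `c`. -/
def elemT (c : ConjClasses Γ) : RGamma Γ :=
  ⟨envι Γ (classSum ℚ c), coeffB_single c ▸ (elemB (Finsupp.single c 1)).2⟩

/-- The generating function `∑_N φ(B_N) x ^ N` of a ring homomorphism `φ : R_Γ → F`. -/
def genFun {F : Type*} [Field F] (φ : RGamma Γ →+* F) : MvPowerSeries (ConjClasses Γ) F :=
  fun N => φ (elemB N)

end RGamma

/-! ### Blocks and central characters -/

section Blocks

/-- A block of a ring `A`: an indecomposable two-sided ideal that is a direct summand of `A`. -/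
structure IsBlock {A : Type*} [Ring A] (C : TwoSidedIdeal A) : Prop where
  ne_bot : C ≠ ⊥
  exists_compl : ∃ D : TwoSidedIdeal A, IsCompl C D
  indecomposable : ∀ I J : TwoSidedIdeal A, I ⊔ J = C → I ⊓ J = ⊥ → I = ⊥ ∨ J = ⊥

/-- A simple module belongs to the block `C` if `C` does not annihilate it. -/
def BelongsTo {A : Type*} [Ring A] (M : Type*) [AddCommGroup M] [Module A M]
    (C : TwoSidedIdeal A) : Prop := ∃ b ∈ C, ∃ m : M, b • m ≠ 0

variable (F : Type*) [Field F] (Γ : Type*) [Group Γ]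

/-- The blocks of the group algebra `FΓ`. -/
def Block : Type _ := {C : TwoSidedIdeal (MonoidAlgebra F Γ) // IsBlock C}

variable {F Γ}

theorem IsBlock.exists_isUnit {A : Type*} [Ring A] {C : TwoSidedIdeal A} (hC : IsBlock C) :
    ∃ e ∈ C, e ≠ 0 ∧ ∀ x ∈ C, e * x = x ∧ x * e = x := by
  obtain ⟨D, hD⟩ := hC.exists_compl
  have h0 : ∀ x ∈ C, ∀ y ∈ D, x * y = 0 ∧ y * x = 0 := fun x hx y hy => by
    have h : ∀ z, z ∈ C → z ∈ D → z = 0 := fun z h1 h2 => by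
      have h3 : z ∈ C ⊓ D := (TwoSidedIdeal.mem_inf _).2 ⟨h1, h2⟩
      rwa [hD.inf_eq_bot, TwoSidedIdeal.mem_bot] at h3
    exact ⟨h _ (C.mul_mem_right _ _ hx) (D.mul_mem_left _ _ hy),
      h _ (C.mul_mem_left _ _ hx) (D.mul_mem_right _ _ hy)⟩
  have h1 : (1 : A) ∈ C ⊔ D := by rw [hD.sup_eq_top]; trivial
  obtain ⟨e, he, f, hf, hef⟩ := TwoSidedIdeal.mem_sup.1 h1
  have hu : ∀ x ∈ C, e * x = x ∧ x * e = x := fun x hx => by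
    constructor
    · calc e * x = (e + f) * x := by rw [add_mul, (h0 x hx f hf).2, add_zero]
        _ = x := by rw [hef, one_mul]
    · calc x * e = x * (e + f) := by rw [mul_add, (h0 x hx f hf).1, add_zero]
        _ = x := by rw [hef, mul_one]
  refine ⟨e, he, fun h => hC.ne_bot ?_, hu⟩
  refine TwoSidedIdeal.ext fun x => ⟨fun hx => ?_, fun hx => ?_⟩
  · rw [TwoSidedIdeal.mem_bot, ← (hu x hx).1, h, zero_mul]
  · rw [(TwoSidedIdeal.mem_bot _).1 hx]; exact C.zero_mem

/-- Splitting an ideal along a central idempotent. -/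
theorem IsBlock.split {A : Type*} [Ring A] {C : TwoSidedIdeal A} (hC : IsBlock C) {f : A}
    (hf : f * f = f) (hz : ∀ x, x * f = f * x) :
    (∀ x ∈ C, f * x = 0) ∨ (∀ x ∈ C, f * x = x) := by
  let I : TwoSidedIdeal A := TwoSidedIdeal.mk' {x | x ∈ C ∧ f * x = x}
    ⟨C.zero_mem, mul_zero _⟩ (fun hx hy => ⟨C.add_mem hx.1 hy.1, by rw [mul_add, hx.2, hy.2]⟩)
    (fun hx => ⟨C.neg_mem hx.1, by rw [mul_neg, hx.2]⟩)
    (fun {x y} hx => ⟨C.mul_mem_left _ _ hx.1, by rw [← mul_assoc, ← hz, mul_assoc, hx.2]⟩)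
    (fun hx => ⟨C.mul_mem_right _ _ hx.1, by rw [← mul_assoc, hx.2]⟩)
  let J : TwoSidedIdeal A := TwoSidedIdeal.mk' {x | x ∈ C ∧ f * x = 0}
    ⟨C.zero_mem, mul_zero _⟩
    (fun hx hy => ⟨C.add_mem hx.1 hy.1, by rw [mul_add, hx.2, hy.2, add_zero]⟩)
    (fun hx => ⟨C.neg_mem hx.1, by rw [mul_neg, hx.2, neg_zero]⟩)
    (fun {x y} hx => ⟨C.mul_mem_left _ _ hx.1, by
      rw [← mul_assoc, ← hz, mul_assoc, hx.2, mul_zero]⟩)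
    (fun hx => ⟨C.mul_mem_right _ _ hx.1, by rw [← mul_assoc, hx.2, zero_mul]⟩)
  have hI : ∀ x, x ∈ I ↔ x ∈ C ∧ f * x = x := fun x => TwoSidedIdeal.mem_mk' _ _ _ _ _ _ x
  have hJ : ∀ x, x ∈ J ↔ x ∈ C ∧ f * x = 0 := fun x => TwoSidedIdeal.mem_mk' _ _ _ _ _ _ x
  have hI' : ∀ x ∈ C, f * x ∈ I := fun x hx =>
    (hI _).2 ⟨C.mul_mem_left _ _ hx, by rw [← mul_assoc, hf]⟩
  have hJ' : ∀ x ∈ C, x - f * x ∈ J := fun x hx =>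
    (hJ _).2 ⟨C.sub_mem hx (C.mul_mem_left _ _ hx), by rw [mul_sub, ← mul_assoc, hf, sub_self]⟩
  have hsup : I ⊔ J = C := by
    refine le_antisymm (sup_le (fun x hx => ((hI x).1 hx).1) (fun x hx => ((hJ x).1 hx).1)) ?_
    intro x hx
    exact TwoSidedIdeal.mem_sup.2 ⟨_, hI' x hx, _, hJ' x hx, by abel⟩
  have hinf : I ⊓ J = ⊥ := by
    refine le_antisymm (fun x hx => ?_) bot_le
    obtain ⟨h1, h2⟩ := (TwoSidedIdeal.mem_inf _).1 hx
    exact (TwoSidedIdeal.mem_bot _).2 (((hI x).1 h1).2.symm.trans ((hJ x).1 h2).2)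
  rcases hC.indecomposable I J hsup hinf with h | h
  · left
    intro x hx
    have := hI' x hx
    rwa [h, TwoSidedIdeal.mem_bot] at this
  · right
    intro x hx
    have := hJ' x hx
    rw [h, TwoSidedIdeal.mem_bot, sub_eq_zero] at this
    exact this.symm

theorem IsBlock.mul_eq_zero {A : Type*} [Ring A] {C D : TwoSidedIdeal A} (hC : IsBlock C)
    (hD : IsBlock D) (hne : C ≠ D) : ∀ x ∈ C, ∀ y ∈ D, y * x = 0 := by
  have key : ∀ {C D : TwoSidedIdeal A}, IsBlock C → IsBlock D →
      (∀ x ∈ C, ∀ y ∈ D, y * x = 0) ∨ C ≤ D := by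
    intro C D hC hD
    obtain ⟨e, he, -, hu⟩ := hD.exists_isUnit
    have hz : ∀ x, x * e = e * x := fun x => by
      rw [← (hu _ (D.mul_mem_left x e he)).1, ← mul_assoc,
        (hu _ (D.mul_mem_right e x he)).2]
    rcases hC.split (hu e he).1 hz with h | h
    · exact Or.inl fun x hx y hy => by rw [← (hu y hy).2, mul_assoc, h x hx, mul_zero]
    · exact Or.inr fun x hx => by rw [← h x hx]; exact D.mul_mem_right _ _ he
  rcases key hC hD with h | h
  · exact h
  rcases key hD hC with h' | h'
  · obtain ⟨e, he, he0, hu⟩ := hC.exists_isUnit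
    exact absurd ((hu e he).1.symm.trans (h' e (h he) e he)) he0
  · exact absurd (le_antisymm h h') hne

/-- Every block has a simple module belonging to it, of the form `FΓ / 𝔪` for a maximal left
ideal `𝔪`. -/
theorem Block.exists_simple (u : Block F Γ) : ∃ 𝔪 : Ideal (MonoidAlgebra F Γ),
    𝔪.IsMaximal ∧ BelongsTo (MonoidAlgebra F Γ ⧸ 𝔪) u.1 := by
  obtain ⟨D, hD⟩ := u.2.exists_compl
  have hDtop : TwoSidedIdeal.asIdeal D ≠ ⊤ := fun h => u.2.ne_bot <| by
    have h1 : D = ⊤ := TwoSidedIdeal.ext fun x => by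
      rw [← TwoSidedIdeal.mem_asIdeal, h]; simp [TwoSidedIdeal.mem_top]
    rw [← inf_top_eq u.1, ← h1, hD.inf_eq_bot]
  obtain ⟨𝔪, hmax, hle⟩ := Ideal.exists_le_maximal _ hDtop
  refine ⟨𝔪, hmax, ?_⟩
  by_contra hcon
  simp only [BelongsTo, not_exists, not_and, not_not] at hcon
  apply hmax.ne_top
  rw [Ideal.eq_top_iff_one]
  have h1 : (1 : MonoidAlgebra F Γ) ∈ u.1 ⊔ D := by rw [hD.sup_eq_top]; trivial
  obtain ⟨b, hb, d, hd, hbd⟩ := TwoSidedIdeal.mem_sup.1 h1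
  rw [← hbd]
  refine 𝔪.add_mem ?_ (hle (TwoSidedIdeal.mem_asIdeal.2 hd))
  have h2 := hcon b hb (Submodule.Quotient.mk 1)
  rwa [← Submodule.Quotient.mk_smul, smul_eq_mul, mul_one, Submodule.Quotient.mk_eq_zero] at h2

variable [Fintype Γ]

instance : Finite (Block F Γ) := by
  choose e he he0 hu using fun u : Block F Γ => u.2.exists_isUnit
  have hli : LinearIndependent F e := by
    rw [linearIndependent_iff']
    intro s g hs u hus
    have h := congrArg (fun x => e u * x) hs
    simp only [Finset.mul_sum, mul_zero] at h
    rw [Finset.sum_eq_single u] at h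
    · rw [mul_smul_comm, (hu u _ (he u)).1] at h
      exact (smul_eq_zero.1 h).resolve_right (he0 u)
    · intro v _ hvu
      rw [mul_smul_comm, v.2.mul_eq_zero u.2 (fun h => hvu (Subtype.ext h)) _ (he v) _ (he u),
        smul_zero]
    · exact fun h => absurd hus h
  exact hli.finite

instance : Fintype (Block F Γ) := Fintype.ofFinite _

variable [IsAlgClosed F]

/-- Central elements act on simple modules by scalars. -/
theorem exists_scalar (M : Type*) [AddCommGroup M] [Module (MonoidAlgebra F Γ) M]
    [IsSimpleModule (MonoidAlgebra F Γ) M] (z : GroupCenter F Γ) :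
    ∃ a : F, ∀ m : M, (z : MonoidAlgebra F Γ) • m = algebraMap F (MonoidAlgebra F Γ) a • m := by
  let _ : Module F M := Module.compHom M (algebraMap F (MonoidAlgebra F Γ))
  have : IsScalarTower F (MonoidAlgebra F Γ) M := ⟨fun a x m => by
    rw [Algebra.smul_def, mul_smul]; rfl⟩
  have : Module.Finite F M := by
    have : Module.Finite (MonoidAlgebra F Γ) M := inferInstance
    exact Module.Finite.trans (MonoidAlgebra F Γ) M
  let T : Module.End (MonoidAlgebra F Γ) M :=
    { toFun := fun m => (z : MonoidAlgebra F Γ) • m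
      map_add' := fun m m' => smul_add _ m m'
      map_smul' := fun x m => by
        rw [RingHom.id_apply, ← mul_smul, ← mul_smul, Subalgebra.mem_center_iff.1 z.2 x] }
  obtain ⟨a, ha⟩ := (IsSimpleModule.algebraMap_end_bijective_of_isAlgClosed F
    (A := MonoidAlgebra F Γ) (V := M)).2 T
  exact ⟨a, fun m => (LinearMap.congr_fun ha m).symm⟩

/-- The central character of a simple `FΓ`-module: the scalar by which `z ∈ Z(FΓ)` acts. -/
def centralCharacter (M : Type*) [AddCommGroup M] [Module (MonoidAlgebra F Γ) M]
    [IsSimpleModule (MonoidAlgebra F Γ) M] (z : GroupCenter F Γ) : F :=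
  (exists_scalar M z).choose

/-- A simple `FΓ`-module belonging to the block `u`. -/
abbrev Block.Simple (u : Block F Γ) : Type _ := MonoidAlgebra F Γ ⧸ u.exists_simple.choose

instance (u : Block F Γ) : IsSimpleModule (MonoidAlgebra F Γ) u.Simple :=
  isSimpleModule_iff_isCoatom.2 u.exists_simple.choose_spec.1.out

/-- The value `ω_c^u` on the class sum `c` of the central character of the block `u`, that is, of a
simple module belonging to `u`; see `blockCharacter_eq` for the independence of the choice. -/
def blockCharacter (u : Block F Γ) (c : ConjClasses Γ) : F :=
  centralCharacter u.Simple (classSum F c)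

theorem centralCharacter_congr (u : Block F Γ) (M M' : Type*) [AddCommGroup M]
    [Module (MonoidAlgebra F Γ) M] [IsSimpleModule (MonoidAlgebra F Γ) M] [AddCommGroup M']
    [Module (MonoidAlgebra F Γ) M'] [IsSimpleModule (MonoidAlgebra F Γ) M']
    (hM : BelongsTo M u.1) (hM' : BelongsTo M' u.1) (z : GroupCenter F Γ) :
    centralCharacter M z = centralCharacter M' z := by
  by_contra hne
  set a := centralCharacter M z with ha
  set a' := centralCharacter M' z with ha'
  obtain ⟨b, hb, m, hm⟩ := hM
  obtain ⟨b', hb', m', hm'⟩ := hM'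
  have : IsArtinianRing (GroupCenter F Γ) := IsArtinianRing.of_finite F _
  let w : GroupCenter F Γ := z - algebraMap F _ a
  obtain ⟨n, y, hy⟩ := IsArtinian.exists_pow_succ_smul_dvd w (1 : GroupCenter F Γ)
  simp only [smul_eq_mul, mul_one] at hy
  have hy1 : w ^ (n + 1) * (w * y) = w ^ (n + 1) := by
    calc w ^ (n + 1) * (w * y) = w * (w ^ (n + 1) * y) := by ring
      _ = w ^ (n + 1) := by rw [hy]; ring
  have hy2 : ∀ k : ℕ, w ^ (n + 1) * (w * y) ^ k = w ^ (n + 1) := fun k => by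
    induction k with
    | zero => simp
    | succ k ih => rw [pow_succ (w * y) k, ← mul_assoc, ih, hy1]
  let f : GroupCenter F Γ := (w * y) ^ (n + 1)
  have hff : f * f = f := by
    calc f * f = w ^ (n + 1) * (w * y) ^ (n + 1) * y ^ (n + 1) := by simp only [f]; ring
      _ = f := by rw [hy2]; simp only [f]; ring
  have hcomm : ∀ (v : GroupCenter F Γ) (x : MonoidAlgebra F Γ), x * v = v * x :=
    fun v => Subalgebra.mem_center_iff.1 v.2
  have hwM : ∀ x : M, (w : MonoidAlgebra F Γ) • x = 0 := fun x => by
    have h := (exists_scalar M z).choose_spec x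
    change (z : MonoidAlgebra F Γ) • x = algebraMap F _ a • x at h
    change ((z : MonoidAlgebra F Γ) - algebraMap F _ a) • x = 0
    rw [sub_smul, h, sub_self]
  have hwM' : ∀ x : M', (w : MonoidAlgebra F Γ) • x =
      algebraMap F (MonoidAlgebra F Γ) (a' - a) • x := fun x => by
    have h := (exists_scalar M' z).choose_spec x
    change (z : MonoidAlgebra F Γ) • x = algebraMap F _ a' • x at h
    change ((z : MonoidAlgebra F Γ) - algebraMap F _ a) • x = _
    rw [sub_smul, h, map_sub, sub_smul]
  rcases u.2.split (f := (f : MonoidAlgebra F Γ)) (congrArg Subtype.val hff) (hcomm f) with h | h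
  · have hpow : ∀ (k : ℕ) (x : M'), ((w ^ k : GroupCenter F Γ) : MonoidAlgebra F Γ) • x =
        algebraMap F (MonoidAlgebra F Γ) ((a' - a) ^ k) • x := fun k => by
      induction k with
      | zero => intro x; rw [pow_zero, pow_zero, map_one, OneMemClass.coe_one]
      | succ k ih =>
        intro x
        rw [pow_succ, Subalgebra.coe_mul, mul_smul, hwM', ih, ← mul_smul, ← map_mul, ← pow_succ]
    have h1 : ((w ^ (n + 1) : GroupCenter F Γ) : MonoidAlgebra F Γ) • (b' • m') = 0 := by
      rw [← hy2 (n + 1), Subalgebra.coe_mul, ← mul_smul, mul_assoc]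
      change ((w ^ (n + 1) : GroupCenter F Γ) * ((f : MonoidAlgebra F Γ) * b') :
        MonoidAlgebra F Γ) • m' = 0
      rw [h b' hb', mul_zero, zero_smul]
    rw [hpow] at h1
    have h2 := congrArg
      (fun x => algebraMap F (MonoidAlgebra F Γ) ((a' - a) ^ (n + 1))⁻¹ • x) h1
    simp only [smul_zero] at h2
    rw [← mul_smul, ← map_mul, inv_mul_cancel₀ (pow_ne_zero _ (sub_ne_zero.2 (Ne.symm hne))), map_one, one_smul] at h2
    exact hm' h2
  · apply hm
    rw [← h b hb, ← hcomm f b, mul_smul]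
    have : (f : MonoidAlgebra F Γ) • m = 0 := by
      have hf : f = (w * y) ^ n * y * w := by simp only [f]; ring
      rw [hf, Subalgebra.coe_mul, mul_smul, hwM, smul_zero]
    rw [this, smul_zero]

/-- Every simple module in the block `u` has central character `ω^u`. -/
theorem blockCharacter_eq (u : Block F Γ) (M : Type*) [AddCommGroup M]
    [Module (MonoidAlgebra F Γ) M] [IsSimpleModule (MonoidAlgebra F Γ) M]
    (hM : BelongsTo M u.1) (c : ConjClasses Γ) :
    centralCharacter M (classSum F c) = blockCharacter u c :=
  centralCharacter_congr u M u.Simple hM u.exists_simple.choose_spec.2 _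

/-- The linear form `∑_c ω_c^u x_c`. -/
def blockForm (u : Block F Γ) : MvPowerSeries (ConjClasses Γ) F :=
  ∑ c : ConjClasses Γ, MvPowerSeries.monomial (Finsupp.single c 1) (blockCharacter u c)

end Blocks

end WeightedIVP

end

/-! Write `Ω(x)` for the generating series of the `B_N`. The logarithm turns products into sums, `T`
is additive, and the exponential turns sums into products. Since class sums multiply with integer
structure constants, `Ω(x) Ω(y) = Ω(F(x, y))`, where `F` is the formal group law with `1 + ∑ c F_c =
(1 + ∑ c x_c)(1 + ∑ c y_c)`, a law with integer coefficients (`isMult_omega`). Comparing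
coefficients writes each `B_N B_M` as an integral combination of the `B_L`, so the span is a ring
(`coe_RGamma`). The `B_N` are linearly independent, because their leading terms are nonzero
multiples of distinct monomials (`linearIndependent_coeffB`). Ring homomorphisms `R_Γ → 𝔽` are
therefore the same as series `G` over `𝔽` with constant term `1` and `G(x) G(y) = G(F(x, y))`, the
series satisfying `IsMult`.

Such a `G` is a character of the groups of power series over `Z(𝔽Γ)` with constant term `1`
(`evalUnit_mul`). Each block idempotent `e_u` cuts out a component of `Z(𝔽Γ)` on which every central
element is the scalar given by `ω^u` plus a nilpotent. In characteristic `p` a high power `q = p^k`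
kills the nilpotents: with `ℓ_u = ∑ ω^u_c x_c`, the generic unit satisfies `(1 + ∑ c x_c)^q = ∏ (1 +
e_u ℓ_u^q)` (`exists_generic_pow_eq`). Hence `G^q` depends only on the restrictions of `G` to the
lines `1 + e_u s`. Each restriction is an endomorphism of the formal multiplicative group over `𝔽`,
hence `(1 + X)^{t_u}` with `t_u ∈ ℤ_p` (`exists_eq_oneAddPow_X`). So `G^q = (∏ (1 + ℓ_u)^{t_u})^q`,
and injectivity of Frobenius removes the exponent.

Conversely, `ω^u` is an algebra homomorphism, so each `(1 + ℓ_u)^t` is multiplicative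
(`isMult_prod_oneAddPow`). The `t_u` are recovered from the product by restricting to the lines,
because `ω^u(e_v) = δ_{uv}` (`prod_oneAddPow_injective`). -/

namespace WeightedIVP

open MvPowerSeries

noncomputable section

/-! ### Truncation of power series by total degree. -/

section EqUpTo

variable {σ τ R S : Type*} [CommRing R] [CommRing S]

/-- Two power series agree in all degrees at most `n`. -/
def EqUpTo (n : ℕ) (f g : MvPowerSeries σ R) : Prop :=
  ∀ N : σ →₀ ℕ, N.degree ≤ n → coeff N f = coeff N g

namespace EqUpTo

variable {n : ℕ} {f g f' g' : MvPowerSeries σ R}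

theorem refl (f : MvPowerSeries σ R) : EqUpTo n f f := fun _ _ => rfl

theorem symm (h : EqUpTo n f g) : EqUpTo n g f := fun N hN => (h N hN).symm

theorem trans {k : MvPowerSeries σ R} (h : EqUpTo n f g) (h' : EqUpTo n g k) : EqUpTo n f k :=
  fun N hN => (h N hN).trans (h' N hN)

theorem ext (h : ∀ n, EqUpTo n f g) : f = g :=
  MvPowerSeries.ext fun N => h N.degree N le_rfl

theorem add (h : EqUpTo n f g) (h' : EqUpTo n f' g') : EqUpTo n (f + f') (g + g') :=
  fun N hN => by rw [map_add, map_add, h N hN, h' N hN]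

theorem mul (h : EqUpTo n f g) (h' : EqUpTo n f' g') : EqUpTo n (f * f') (g * g') := by
  classical
  intro N hN
  rw [coeff_mul, coeff_mul]
  refine Finset.sum_congr rfl fun x hx => ?_
  have hx' : x.1.degree + x.2.degree = N.degree := by
    rw [← map_add, Finset.HasAntidiagonal.mem_antidiagonal.1 hx]
  rw [h x.1 (by omega), h' x.2 (by omega)]

theorem prod {ι : Type*} (s : Finset ι) {f g : ι → MvPowerSeries σ R}
    (h : ∀ i ∈ s, EqUpTo n (f i) (g i)) : EqUpTo n (∏ i ∈ s, f i) (∏ i ∈ s, g i) := by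
  classical
  induction s using Finset.induction_on with
  | empty => exact refl _
  | insert i s hi ih =>
    rw [Finset.prod_insert hi, Finset.prod_insert hi]
    exact (h i (Finset.mem_insert_self i s)).mul
      (ih fun j hj => h j (Finset.mem_insert_of_mem hj))

theorem pderiv {i : σ} (h : EqUpTo (n + 1) f g) :
    EqUpTo n (MvPowerSeries.pderiv R i f) (MvPowerSeries.pderiv R i g) := fun N hN => by
  rw [coeff_pderiv, coeff_pderiv, h _ (by simpa using hN)]

theorem pow_zero_of_lt {k : ℕ} (hf : constantCoeff f = 0) (hk : n < k) : EqUpTo n (f ^ k) 0 :=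
  fun N hN => by
    rw [map_zero]
    refine coeff_of_lt_order (lt_of_lt_of_le ?_ (le_order_pow_of_constantCoeff_eq_zero k hf))
    exact_mod_cast lt_of_le_of_lt hN hk

end EqUpTo

/-- Every factor has order at least its exponent. This makes substitution compatible with truncation
and its coefficients finite sums. -/
theorem coeff_prod_pow_eq_zero {a : σ → MvPowerSeries τ S} (ha : ∀ s, constantCoeff (a s) = 0)
    {d : σ →₀ ℕ} {e : τ →₀ ℕ} (h : e.degree < d.degree) :
    coeff e (d.prod fun s k => a s ^ k) = 0 := by
  refine coeff_of_lt_order (lt_of_lt_of_le (b := ((d.degree : ℕ) : ℕ∞)) (by exact_mod_cast h) ?_)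
  refine le_trans ?_ (le_order_prod _ _)
  rw [Finsupp.degree_apply, Nat.cast_sum]
  exact Finset.sum_le_sum fun s _ => le_order_pow_of_constantCoeff_eq_zero _ (ha s)

variable [Algebra R S] [Finite σ]

theorem EqUpTo.subst {n : ℕ} {f g : MvPowerSeries σ R} {a : σ → MvPowerSeries τ S}
    (ha : ∀ s, constantCoeff (a s) = 0) (h : EqUpTo n f g) :
    EqUpTo n (MvPowerSeries.subst a f) (MvPowerSeries.subst a g) := fun e he => by
  rw [coeff_subst (hasSubst_of_constantCoeff_zero ha),
    coeff_subst (hasSubst_of_constantCoeff_zero ha)]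
  refine finsum_congr fun d => ?_
  rcases le_or_gt d.degree n with hd | hd
  · rw [h d hd]
  · rw [coeff_prod_pow_eq_zero ha (by omega), smul_zero, smul_zero]

/-- The exponents of degree at most `n`. -/
def exponentsLE (σ : Type*) [Finite σ] (n : ℕ) : Finset (σ →₀ ℕ) :=
  (Finsupp.finite_of_degree_le n).toFinset

theorem mem_exponentsLE {n : ℕ} {d : σ →₀ ℕ} : d ∈ exponentsLE σ n ↔ d.degree ≤ n := by
  simp [exponentsLE]

theorem coeff_subst_eq_sum {a : σ → MvPowerSeries τ S} (ha : ∀ s, constantCoeff (a s) = 0)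
    (f : MvPowerSeries σ R) (e : τ →₀ ℕ) :
    coeff e (MvPowerSeries.subst a f) =
      ∑ d ∈ exponentsLE σ e.degree, coeff d f • coeff e (d.prod fun s k => a s ^ k) := by
  rw [coeff_subst (hasSubst_of_constantCoeff_zero ha)]
  refine finsum_eq_sum_of_support_subset _ fun d hd => ?_
  rw [Finset.mem_coe, mem_exponentsLE]
  by_contra! hlt
  exact hd (by beta_reduce; rw [coeff_prod_pow_eq_zero ha hlt, smul_zero])

theorem constantCoeff_subst_zero {a : σ → MvPowerSeries τ S}
    (ha : ∀ s, constantCoeff (a s) = 0) (f : MvPowerSeries σ R) :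
    constantCoeff (MvPowerSeries.subst a f) = algebraMap R S (constantCoeff f) := by
  rw [← coeff_zero_eq_constantCoeff_apply, coeff_subst_eq_sum ha, Finset.sum_eq_single 0]
  · simp [Algebra.smul_def]
  · intro d hd hd0
    rw [mem_exponentsLE] at hd
    exact absurd ((Finsupp.degree_eq_zero_iff d).1 (by simpa using hd)) hd0
  · simp [mem_exponentsLE]

end EqUpTo

/-! ### Functional equations of the formal logarithm and exponential. -/

section ExpLog

variable {σ τ A : Type*} [CommRing A] [Algebra ℚ A]

theorem formalExp_eqUpTo {f : MvPowerSeries σ A} (hf : constantCoeff f = 0) (n : ℕ) :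
    EqUpTo n (formalExp f) (∑ k ∈ Finset.range (n + 1), ((k.factorial : ℚ)⁻¹) • f ^ k) := by
  intro N hN
  rw [map_sum]
  change ∑ k ∈ Finset.range (N.degree + 1), _ = _
  refine Finset.sum_subset (Finset.range_subset_range.2 (by omega)) fun k _ hk => ?_
  rw [Finset.mem_range, not_lt] at hk
  rw [EqUpTo.pow_zero_of_lt hf hk N le_rfl, map_zero, smul_zero]

theorem formalLogOneAdd_eqUpTo {f : MvPowerSeries σ A} (hf : constantCoeff f = 0) (n : ℕ) :
    EqUpTo n (formalLogOneAdd f) (∑ k ∈ Finset.Icc 1 n, ((-1 : ℚ) ^ (k + 1) / k) • f ^ k) := by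
  intro N hN
  rw [map_sum]
  change ∑ k ∈ Finset.Icc 1 N.degree, _ = _
  refine Finset.sum_subset (Finset.Icc_subset_Icc_right hN) fun k hk hk' => ?_
  rw [Finset.mem_Icc] at hk hk'
  have : coeff N (f ^ k) = 0 := by
    rw [EqUpTo.pow_zero_of_lt hf (n := N.degree) (by omega) N le_rfl, map_zero]
  change _ • coeff N (f ^ k) = 0
  rw [this, smul_zero]

theorem constantCoeff_formalLogOneAdd (f : MvPowerSeries σ A) :
    constantCoeff (formalLogOneAdd f) = 0 := by
  rw [← coeff_zero_eq_constantCoeff_apply, coeff_apply]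
  simp [formalLogOneAdd]

theorem constantCoeff_formalExp (f : MvPowerSeries σ A) :
    constantCoeff (formalExp f) = 1 := by
  rw [← coeff_zero_eq_constantCoeff_apply, coeff_apply]
  simp [formalExp]

/-- The derivative of the truncated logarithm is a geometric sum in `-f` times the derivative of
`f`. Multiplying by `1 + f` telescopes it, with an error divisible by `f ^ (n + 1)`, which is
invisible up to degree `n`. -/
theorem pderiv_formalLogOneAdd {f : MvPowerSeries σ A} (hf : constantCoeff f = 0) (i : σ) :
    pderiv A i (formalLogOneAdd f) * (1 + f) = pderiv A i f := by
  refine EqUpTo.ext fun n => ?_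
  refine ((formalLogOneAdd_eqUpTo hf (n + 1)).pderiv.mul (EqUpTo.refl (1 + f))).trans ?_
  have key : pderiv A i (∑ k ∈ Finset.Icc 1 (n + 1), ((-1 : ℚ) ^ (k + 1) / k) • f ^ k) * (1 + f) =
      (1 - (-1) ^ (n + 1) * f ^ (n + 1)) * pderiv A i f := by
    have h : pderiv A i (∑ k ∈ Finset.Icc 1 (n + 1), ((-1 : ℚ) ^ (k + 1) / k) • f ^ k) =
        (∑ k ∈ Finset.range (n + 1), (-f) ^ k) * pderiv A i f := by
      rw [map_sum, Finset.sum_mul, ← Finset.sum_bij (i := fun k _ => k + 1) (s := Finset.range (n + 1))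
        (f := fun k => (-f) ^ k * pderiv A i f)]
      · intro k hk
        simp only [Finset.mem_range, Finset.mem_Icc] at hk ⊢
        omega
      · intro a _ b _ h
        omega
      · intro b hb
        rw [Finset.mem_Icc] at hb
        exact ⟨b - 1, Finset.mem_range.2 (by omega), by omega⟩
      · intro k _
        rw [Derivation.map_smul_of_tower, pderiv_pow]
        simp only [Nat.add_sub_cancel]
        rw [mul_assoc, ← nsmul_eq_mul, ← Nat.cast_smul_eq_nsmul ℚ, smul_smul,
          div_mul_cancel₀ _ (by positivity), neg_pow f k, mul_assoc, pow_add, pow_add]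
        have h1 : ((-1 : ℚ) ^ k * (-1) ^ 1 * (-1) ^ 1) • (f ^ k * pderiv A i f) =
          ((-1 : ℤ) ^ k) • (f ^ k * pderiv A i f) := by
          rw [← Int.cast_smul_eq_zsmul ℚ]
          simp
        rw [h1, zsmul_eq_mul]
        simp
    rw [h]
    have hg := geom_sum_mul_neg (-f) (n + 1)
    rw [neg_pow f (n + 1)] at hg
    rw [← hg]
    ring
  rw [key]
  have h2 : EqUpTo n (1 - (-1) ^ (n + 1) * f ^ (n + 1)) 1 := by
    have := ((EqUpTo.refl (n := n) (-(-1) ^ (n + 1) : MvPowerSeries σ A)).mul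
      (EqUpTo.pow_zero_of_lt hf (Nat.lt_succ_self n)))
    have := (EqUpTo.refl (n := n) (1 : MvPowerSeries σ A)).add this
    simpa [sub_eq_add_neg] using this
  simpa using h2.mul (EqUpTo.refl (pderiv A i f))

theorem pderiv_formalExp {f : MvPowerSeries σ A} (hf : constantCoeff f = 0) (i : σ) :
    pderiv A i (formalExp f) = formalExp f * pderiv A i f := by
  refine EqUpTo.ext fun n => ?_
  refine (formalExp_eqUpTo hf (n + 1)).pderiv.trans ?_
  refine EqUpTo.trans ?_ ((formalExp_eqUpTo hf n).symm.mul (EqUpTo.refl _))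
  rw [map_sum, Finset.sum_range_succ', Finset.sum_mul]
  simp only [Derivation.map_smul_of_tower, pow_zero, Derivation.map_one_eq_zero, smul_zero,
    add_zero, pderiv_pow, Nat.add_sub_cancel]
  intro N _
  congr 1
  refine Finset.sum_congr rfl fun k _ => ?_
  rw [mul_assoc, ← nsmul_eq_mul, ← Nat.cast_smul_eq_nsmul ℚ, smul_smul, smul_mul_assoc]
  congr 1
  rw [Nat.factorial_succ]
  push_cast
  field_simp

theorem isAddTorsionFree_of_rat (A : Type*) [CommRing A] [Algebra ℚ A] : IsAddTorsionFree A :=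
  IsAddTorsionFree.of_module_rat A

/-- Over a torsion-free ring a series is determined by its constant term and its partial
derivatives. The derivatives are compared after multiplication by the unit `(1 + f)(1 + g)`. -/
theorem formalLogOneAdd_mul {f g : MvPowerSeries σ A} (hf : constantCoeff f = 0)
    (hg : constantCoeff g = 0) :
    formalLogOneAdd (f + g + f * g) = formalLogOneAdd f + formalLogOneAdd g := by
  have := isAddTorsionFree_of_rat A
  refine pderiv.ext (fun i => ?_) (by simp [constantCoeff_formalLogOneAdd])
  have hu : IsUnit ((1 + f) * (1 + g)) := by
    rw [isUnit_iff_constantCoeff]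
    simp [hf, hg]
  refine hu.mul_left_injective ?_
  have h1 := pderiv_formalLogOneAdd (f := f + g + f * g) (by simp [hf, hg]) i
  have h2 := pderiv_formalLogOneAdd hf i
  have h3 := pderiv_formalLogOneAdd hg i
  have h4 : (1 + f) * (1 + g) = 1 + (f + g + f * g) := by ring
  beta_reduce
  rw [h4, h1, map_add, map_add, map_add, Derivation.leibniz, smul_eq_mul, smul_eq_mul,
    ← h4, ← h2, ← h3]
  ring

theorem formalExp_mul_neg {f : MvPowerSeries σ A} (hf : constantCoeff f = 0) :
    formalExp f * formalExp (-f) = 1 := by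
  have := isAddTorsionFree_of_rat A
  refine pderiv.ext (fun i => ?_) (by simp [constantCoeff_formalExp])
  rw [Derivation.leibniz, pderiv_formalExp hf, pderiv_formalExp (by simp [hf]), map_neg,
    pderiv_one, smul_eq_mul, smul_eq_mul]
  ring

/-- All partial derivatives of `exp(f + g) exp(-f) exp(-g)` vanish, so it is the constant `1`. -/
theorem formalExp_add {f g : MvPowerSeries σ A} (hf : constantCoeff f = 0)
    (hg : constantCoeff g = 0) : formalExp (f + g) = formalExp f * formalExp g := by
  have := isAddTorsionFree_of_rat A
  have h : formalExp (f + g) * (formalExp (-f) * formalExp (-g)) = 1 := by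
    have hf' : constantCoeff (-f) = 0 := by rw [map_neg, hf, neg_zero]
    have hg' : constantCoeff (-g) = 0 := by rw [map_neg, hg, neg_zero]
    have hfg : constantCoeff (f + g) = 0 := by rw [map_add, hf, hg, add_zero]
    refine pderiv.ext (fun i => ?_) (by simp [constantCoeff_formalExp])
    rw [Derivation.leibniz, Derivation.leibniz, pderiv_formalExp hfg, pderiv_formalExp hf',
      pderiv_formalExp hg', map_neg, map_neg, map_add, pderiv_one]
    simp only [smul_eq_mul]
    ring
  calc formalExp (f + g)
      = formalExp (f + g) * ((formalExp f * formalExp (-f)) * (formalExp g * formalExp (-g))) := by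
        rw [formalExp_mul_neg hf, formalExp_mul_neg hg, mul_one, mul_one]
    _ = formalExp (f + g) * (formalExp (-f) * formalExp (-g)) * (formalExp f * formalExp g) := by
        ring
    _ = formalExp f * formalExp g := by rw [h, one_mul]

variable [Finite σ]

theorem subst_formalLogOneAdd {a : σ → MvPowerSeries τ A} (ha : ∀ s, constantCoeff (a s) = 0)
    {f : MvPowerSeries σ A} (hf : constantCoeff f = 0) :
    subst a (formalLogOneAdd f) = formalLogOneAdd (subst a f) := by
  refine EqUpTo.ext fun n => ((formalLogOneAdd_eqUpTo hf n).subst ha).trans ?_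
  refine EqUpTo.trans ?_ (formalLogOneAdd_eqUpTo (by simp [constantCoeff_subst_zero ha, hf]) n).symm
  rw [← coe_substAlgHom (hasSubst_of_constantCoeff_zero ha), map_sum]
  simp only [AlgHom.map_smul_of_tower, map_pow]
  exact EqUpTo.refl _

theorem subst_formalExp {a : σ → MvPowerSeries τ A} (ha : ∀ s, constantCoeff (a s) = 0)
    {f : MvPowerSeries σ A} (hf : constantCoeff f = 0) :
    subst a (formalExp f) = formalExp (subst a f) := by
  refine EqUpTo.ext fun n => ((formalExp_eqUpTo hf n).subst ha).trans ?_
  refine EqUpTo.trans ?_ (formalExp_eqUpTo (by simp [constantCoeff_subst_zero ha, hf]) n).symm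
  rw [← coe_substAlgHom (hasSubst_of_constantCoeff_zero ha), map_sum]
  simp only [AlgHom.map_smul_of_tower, map_pow]
  exact EqUpTo.refl _

end ExpLog

end

end WeightedIVP

namespace WeightedIVP

open MvPowerSeries

noncomputable section

/-! ### The formal group law with given integer structure constants and its multiplicative series.
-/

section Convolution

variable {σ : Type*} [Fintype σ] (a : σ → σ → σ → ℤ)

/-- Coordinates of `s + t + s t` in an algebra with structure constants `a`. -/
def conv {R : Type*} [CommRing R] (s t : σ → R) (e : σ) : R :=
  s e + t e + ∑ c, ∑ d, (a c d e : R) * (s c * t d)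

theorem map_conv {R S : Type*} [CommRing R] [CommRing S] (φ : R →+* S) (s t : σ → R) (e : σ) :
    φ (conv a s t e) = conv a (fun c => φ (s c)) (fun c => φ (t c)) e := by
  simp [conv, map_sum]

variable {a}

/-- Adding `1` to both sides, `s ↦ 1 + ∑ κ_e s_e` turns `conv` into multiplication. The `κ_e` need
not be independent: they will be class sums, but also the scalars `ω^u_c`. -/
theorem sum_mul_conv {B : Type*} [CommRing B] {κ : σ → B}
    (hκ : ∀ c d, κ c * κ d = ∑ e, (a c d e : B) * κ e) (s t : σ → B) :
    ∑ e, κ e * conv a s t e =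
      ∑ e, κ e * s e + ∑ e, κ e * t e + (∑ e, κ e * s e) * ∑ e, κ e * t e := by
  have h : (∑ e, κ e * s e) * ∑ e, κ e * t e =
      ∑ e, κ e * ∑ c, ∑ d, (a c d e : B) * (s c * t d) := by
    rw [Finset.sum_mul_sum]
    simp only [Finset.mul_sum]
    rw [Finset.sum_comm (s := Finset.univ (α := σ)) (t := Finset.univ (α := σ))
      (f := fun e c => ∑ d, κ e * ((a c d e : B) * (s c * t d)))]
    refine Finset.sum_congr rfl fun c _ => ?_
    rw [Finset.sum_comm]
    refine Finset.sum_congr rfl fun d _ => ?_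
    calc κ c * s c * (κ d * t d) = (κ c * κ d) * (s c * t d) := by ring
      _ = _ := by
        rw [hκ, Finset.sum_mul]
        exact Finset.sum_congr rfl fun e _ => by ring
  rw [h, ← Finset.sum_add_distrib, ← Finset.sum_add_distrib]
  exact Finset.sum_congr rfl fun e _ => by rw [conv]; ring

theorem constantCoeff_conv {τ R : Type*} [CommRing R] {s t : σ → MvPowerSeries τ R}
    (hs : ∀ c, constantCoeff (s c) = 0) (ht : ∀ c, constantCoeff (t c) = 0) (e : σ) :
    constantCoeff (conv a s t e) = 0 := by
  simp [conv, hs, ht]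

end Convolution

theorem map_prod_pow {σ τ R S : Type*} [CommRing R] [CommRing S] (φ : R →+* S)
    (s : σ → MvPowerSeries τ R) (L : σ →₀ ℕ) :
    map φ (L.prod fun c k => s c ^ k) = L.prod fun c k => map φ (s c) ^ k := by
  rw [Finsupp.prod, Finsupp.prod, map_prod]
  simp only [map_pow]

section Multiplicative

variable {σ : Type*} [Fintype σ] (a : σ → σ → σ → ℤ) {R : Type*} [CommRing R]

/-- The formal group law with structure constants `a`. -/
def groupLaw (R : Type*) [CommRing R] : σ → MvPowerSeries (σ ⊕ σ) R :=
  conv a (fun c => X (Sum.inl c)) (fun c => X (Sum.inr c))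

theorem constantCoeff_groupLaw (e : σ) : constantCoeff (groupLaw a R e) = 0 :=
  constantCoeff_conv (by simp) (by simp) e

theorem map_groupLaw {S : Type*} [CommRing S] (φ : R →+* S) (e : σ) :
    map φ (groupLaw a R e) = groupLaw a S e := by
  simp [groupLaw, map_conv]

/-- The coefficient of `x ^ N y ^ M` in the `L`-th power of the formal group law. -/
def structConst (N M L : σ →₀ ℕ) : ℤ :=
  coeff (Finsupp.sumElim N M) (L.prod fun s k => groupLaw a ℤ s ^ k)

theorem degree_sumElim (N M : σ →₀ ℕ) :
    (Finsupp.sumElim N M).degree = N.degree + M.degree := by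
  rw [Finsupp.degree_eq_sum, Finsupp.degree_eq_sum, Finsupp.degree_eq_sum, Fintype.sum_sum_type]
  simp

/-- The group law comes from `ℤ`, so the same integers `structConst` serve for every coefficient
ring. Only `|L| ≤ |N| + |M|` occurs, as the law has no constant term. -/
theorem coeff_subst_groupLaw (G : MvPowerSeries σ R) (N M : σ →₀ ℕ) :
    coeff (Finsupp.sumElim N M) (subst (groupLaw a R) G) =
      ∑ L ∈ exponentsLE σ (N.degree + M.degree), (structConst a N M L : R) * coeff L G := by
  rw [coeff_subst_eq_sum (constantCoeff_groupLaw a), degree_sumElim]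
  refine Finset.sum_congr rfl fun L _ => ?_
  have h : (L.prod fun s k => groupLaw a R s ^ k) =
      map (Int.castRingHom R) (L.prod fun s k => groupLaw a ℤ s ^ k) := by
    rw [Finsupp.prod, Finsupp.prod, map_prod]
    simp only [map_pow, map_groupLaw]
  rw [h, coeff_map, smul_eq_mul, mul_comm]
  rfl

theorem coeff_rename_inl_mul_rename_inr (f g : MvPowerSeries σ R) (N M : σ →₀ ℕ) :
    coeff (Finsupp.sumElim N M)
      (rename (Sum.inl : σ → σ ⊕ σ) f * rename (Sum.inr : σ → σ ⊕ σ) g) =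
      coeff N f * coeff M g := by
  classical
  have hl : ∀ N : σ →₀ ℕ, Finsupp.embDomain (Function.Embedding.inl : σ ↪ σ ⊕ σ) N =
      Finsupp.sumElim N 0 := fun N => by
    ext i
    rcases i with i | i
    · exact Finsupp.embDomain_apply_self (Function.Embedding.inl : σ ↪ σ ⊕ σ) N i
    · exact Finsupp.embDomain_of_notMem_range _ _ _ (by simp)
  have hr : ∀ N : σ →₀ ℕ, Finsupp.embDomain (Function.Embedding.inr : σ ↪ σ ⊕ σ) N =
      Finsupp.sumElim 0 N := fun N => by
    ext i
    rcases i with i | i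
    · exact Finsupp.embDomain_of_notMem_range _ _ _ (by simp)
    · exact Finsupp.embDomain_apply_self (Function.Embedding.inr : σ ↪ σ ⊕ σ) N i
  have hl' : ∀ N : σ →₀ ℕ, coeff (Finsupp.sumElim N 0) (rename (Sum.inl : σ → σ ⊕ σ) f) =
      coeff N f := fun N => by
    rw [← hl]; exact coeff_embDomain_rename (Function.Embedding.inl : σ ↪ σ ⊕ σ) f N
  have hr' : ∀ N : σ →₀ ℕ, coeff (Finsupp.sumElim 0 N) (rename (Sum.inr : σ → σ ⊕ σ) g) =
      coeff N g := fun N => by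
    rw [← hr]; exact coeff_embDomain_rename (Function.Embedding.inr : σ ↪ σ ⊕ σ) g N
  rw [coeff_mul, Finset.sum_eq_single (Finsupp.sumElim N 0, Finsupp.sumElim 0 M)]
  · rw [hl', hr']
  · rintro ⟨x, y⟩ hxy hne
    rw [Finset.HasAntidiagonal.mem_antidiagonal] at hxy
    by_contra hcon
    obtain ⟨hx, hy⟩ := ne_zero_and_ne_zero_of_mul hcon
    have hx' : x ∈ Set.range (Finsupp.mapDomain (Sum.inl : σ → σ ⊕ σ)) := by
      by_contra h
      exact hx (coeff_rename_eq_zero _ _ h)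
    have hy' : y ∈ Set.range (Finsupp.mapDomain (Sum.inr : σ → σ ⊕ σ)) := by
      by_contra h
      exact hy (coeff_rename_eq_zero _ _ h)
    obtain ⟨x, rfl⟩ := hx'
    obtain ⟨y, rfl⟩ := hy'
    have e1 : Finsupp.mapDomain (Sum.inl : σ → σ ⊕ σ) x = Finsupp.sumElim x 0 := by
      rw [← hl, Finsupp.embDomain_eq_mapDomain]; rfl
    have e2 : Finsupp.mapDomain (Sum.inr : σ → σ ⊕ σ) y = Finsupp.sumElim 0 y := by
      rw [← hr, Finsupp.embDomain_eq_mapDomain]; rfl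
    simp only [e1, e2] at hxy hne
    apply hne
    have hx : x = N := by
      ext i
      simpa using DFunLike.congr_fun hxy (Sum.inl i)
    have hy : y = M := by
      ext i
      simpa using DFunLike.congr_fun hxy (Sum.inr i)
    rw [hx, hy]
  · intro h
    refine absurd ?_ h
    rw [Finset.HasAntidiagonal.mem_antidiagonal]
    ext i
    rcases i with i | i <;> simp

/-- A power series that is a homomorphism from the formal group with structure constants `a` to the
formal multiplicative group. -/
structure IsMult (G : MvPowerSeries σ R) : Prop where
  constantCoeff_eq : constantCoeff G = 1
  rename_mul : rename (Sum.inl : σ → σ ⊕ σ) G * rename (Sum.inr : σ → σ ⊕ σ) G =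
    subst (groupLaw a R) G

variable {a}

/-- The dictionary between functional equations and multiplication tables. Applied to `Ω` it shows
that the `B_N` span a ring; applied over a field it characterises the homomorphisms out of that
ring. -/
theorem isMult_iff {G : MvPowerSeries σ R} : IsMult a G ↔ constantCoeff G = 1 ∧
    ∀ N M : σ →₀ ℕ, coeff N G * coeff M G =
      ∑ L ∈ exponentsLE σ (N.degree + M.degree), (structConst a N M L : R) * coeff L G := by
  constructor
  · rintro ⟨h1, h2⟩
    refine ⟨h1, fun N M => ?_⟩
    rw [← coeff_rename_inl_mul_rename_inr, h2, coeff_subst_groupLaw]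
  · rintro ⟨h1, h2⟩
    refine ⟨h1, MvPowerSeries.ext fun e => ?_⟩
    obtain ⟨⟨N, M⟩, rfl⟩ := Finsupp.sumFinsuppEquivProdFinsupp.symm.surjective e
    have := (coeff_rename_inl_mul_rename_inr G G N M).trans
      ((h2 N M).trans (coeff_subst_groupLaw a G N M).symm)
    exact this

/-- The two sets of variables in the functional equation are universal, so they may be specialised
to any series without constant term. -/
theorem IsMult.subst_mul_subst {G : MvPowerSeries σ R} (hG : IsMult a G) {τ : Type*}
    {s t : σ → MvPowerSeries τ R} (hs : ∀ c, constantCoeff (s c) = 0)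
    (ht : ∀ c, constantCoeff (t c) = 0) :
    subst s G * subst t G = subst (conv a s t) G := by
  have hst : HasSubst (Sum.elim s t) := hasSubst_of_constantCoeff_zero (by simp [hs, ht])
  have h := congrArg (subst (Sum.elim s t)) hG.rename_mul
  rw [subst_mul hst, rename_eq_subst, rename_eq_subst,
    subst_comp_subst_apply (HasSubst.X_comp _) hst, subst_comp_subst_apply (HasSubst.X_comp _) hst,
    subst_comp_subst_apply (hasSubst_of_constantCoeff_zero (constantCoeff_groupLaw a)) hst] at h
  convert h using 3
  · funext c
    rw [Function.comp_apply, subst_X hst, Sum.elim_inl]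
  · funext c
    rw [Function.comp_apply, subst_X hst, Sum.elim_inr]
  · funext c
    rw [groupLaw, ← coe_substAlgHom hst, ← AlgHom.coe_toRingHom, map_conv]
    simp only [AlgHom.coe_toRingHom, coe_substAlgHom, subst_X hst, Sum.elim_inl, Sum.elim_inr]

end Multiplicative

/-! ### Multiplicativity of `exp (T (log (1 + f)))`. -/

section Envelope

variable {σ : Type*} {A U : Type*} [CommRing A] [Algebra ℚ A] [CommRing U] [Algebra ℚ U]

/-- The coefficientwise extension of a linear map to power series. -/
def mapCoeff (ι : A →ₗ[ℚ] U) (f : MvPowerSeries σ A) : MvPowerSeries σ U :=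
  fun N => ι (coeff N f)

theorem coeff_mapCoeff (ι : A →ₗ[ℚ] U) (f : MvPowerSeries σ A) (N : σ →₀ ℕ) :
    coeff N (mapCoeff ι f) = ι (coeff N f) := rfl

theorem mapCoeff_add (ι : A →ₗ[ℚ] U) (f g : MvPowerSeries σ A) :
    mapCoeff ι (f + g) = mapCoeff ι f + mapCoeff ι g := by
  ext N
  simp [coeff_mapCoeff]

/-- `exp (T (log (1 + f)))`, where `T` is the coefficientwise extension of `ι`. -/
def expLog (ι : A →ₗ[ℚ] U) (f : MvPowerSeries σ A) : MvPowerSeries σ U :=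
  formalExp (mapCoeff ι (formalLogOneAdd f))

theorem constantCoeff_mapCoeff_log (ι : A →ₗ[ℚ] U) (f : MvPowerSeries σ A) :
    constantCoeff (mapCoeff ι (formalLogOneAdd f)) = 0 := by
  rw [← coeff_zero_eq_constantCoeff_apply, coeff_mapCoeff, coeff_zero_eq_constantCoeff_apply,
    constantCoeff_formalLogOneAdd, map_zero]

theorem expLog_mul (ι : A →ₗ[ℚ] U) {f g : MvPowerSeries σ A} (hf : constantCoeff f = 0)
    (hg : constantCoeff g = 0) : expLog ι (f + g + f * g) = expLog ι f * expLog ι g := by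
  rw [expLog, formalLogOneAdd_mul hf hg, mapCoeff_add,
    formalExp_add (constantCoeff_mapCoeff_log ι f) (constantCoeff_mapCoeff_log ι g)]
  rfl

variable {τ : Type*}

theorem smul_coeff_prod_map_pow {B : Type*} [CommRing B] (s : σ → MvPowerSeries τ ℤ) (x : B)
    (L : σ →₀ ℕ) (e : τ →₀ ℕ) :
    x • coeff e (L.prod fun c k => map (Int.castRingHom B) (s c) ^ k) =
      coeff e (L.prod fun c k => s c ^ k) • x := by
  rw [← map_prod_pow, coeff_map, smul_eq_mul, mul_comm, zsmul_eq_mul]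
  rfl

/-- The map `ι` is only linear, so it would not commute with a general substitution. Here the
substituted series have integer coefficients, so each new coefficient is a `ℤ`-linear combination of
old ones. -/
theorem mapCoeff_subst [Finite σ] (ι : A →ₗ[ℚ] U) {s : σ → MvPowerSeries τ ℤ}
    (hs : ∀ c, constantCoeff (s c) = 0) (f : MvPowerSeries σ A) :
    mapCoeff ι (subst (fun c => map (Int.castRingHom A) (s c)) f) =
      subst (fun c => map (Int.castRingHom U) (s c)) (mapCoeff ι f) := by
  ext e
  rw [coeff_mapCoeff, coeff_subst_eq_sum (by simp [hs]), coeff_subst_eq_sum (by simp [hs]), map_sum]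
  refine Finset.sum_congr rfl fun L _ => ?_
  rw [smul_coeff_prod_map_pow, map_zsmul, smul_coeff_prod_map_pow, coeff_mapCoeff]

variable [Fintype σ] (κ : σ → A)

/-- The linear form `∑_c κ_c x_c`. -/
def genericForm : MvPowerSeries σ A := ∑ c, C (κ c) * X c

theorem subst_expLog_genericForm (ι : A →ₗ[ℚ] U) {s : σ → MvPowerSeries τ ℤ}
    (hs : ∀ c, constantCoeff (s c) = 0) :
    subst (fun c => map (Int.castRingHom U) (s c)) (expLog ι (genericForm κ)) =
      expLog ι (∑ c, C (κ c) * map (Int.castRingHom A) (s c)) := by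
  have hA : ∀ c, constantCoeff (map (Int.castRingHom A) (s c)) = 0 := by simp [hs]
  have hU : ∀ c, constantCoeff (map (Int.castRingHom U) (s c)) = 0 := by simp [hs]
  have hg : constantCoeff (genericForm κ) = 0 := by simp [genericForm]
  have hgs : subst (fun c => map (Int.castRingHom A) (s c)) (genericForm κ) =
      ∑ c, C (κ c) * map (Int.castRingHom A) (s c) := by
    have h := hasSubst_of_constantCoeff_zero hA
    rw [genericForm, ← coe_substAlgHom h, map_sum]
    refine Finset.sum_congr rfl fun c _ => ?_
    rw [map_mul, coe_substAlgHom, subst_X h, subst_C]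
  rw [expLog, subst_formalExp hU (constantCoeff_mapCoeff_log ι _), ← mapCoeff_subst ι hs,
    subst_formalLogOneAdd hA hg, hgs]
  rfl

/-- All three substitutions have integer coefficients, so they pass inside `exp T log`. There the
claim becomes `expLog_mul` for the product of two copies of the generic unit. -/
theorem isMult_expLog_genericForm (ι : A →ₗ[ℚ] U) {a : σ → σ → σ → ℤ}
    (hκ : ∀ c d, κ c * κ d = ∑ e, (a c d e : A) * κ e) :
    IsMult a (expLog ι (genericForm κ)) := by
  refine ⟨constantCoeff_formalExp _, ?_⟩
  have h1 := subst_expLog_genericForm κ ι (s := fun c : σ => X (Sum.inl c : σ ⊕ σ)) (by simp)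
  have h2 := subst_expLog_genericForm κ ι (s := fun c : σ => X (Sum.inr c : σ ⊕ σ)) (by simp)
  have h3 := subst_expLog_genericForm κ ι (s := groupLaw a ℤ) (constantCoeff_groupLaw a)
  simp only [map_X, map_groupLaw] at h1 h2 h3
  have h4 := sum_mul_conv (a := a) (κ := fun c => C (σ := σ ⊕ σ) (κ c))
    (fun c d => by simp only [← map_mul, hκ, map_sum]; simp)
    (fun c => X (Sum.inl c)) (fun c => X (Sum.inr c))
  rw [rename_eq_subst, rename_eq_subst]
  change subst (fun c => X (Sum.inl c)) _ * subst (fun c => X (Sum.inr c)) _ =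
    subst (fun c => groupLaw a U c) _
  rw [h1, h2, h3, ← expLog_mul ι (by simp) (by simp), ← h4]
  rfl

end Envelope

end

end WeightedIVP

namespace WeightedIVP

open MvPowerSeries

noncomputable section

open scoped Classical

/-! ### Class sums as a basis of the centre, with integer structure constants. -/

section ClassSums

variable {k : Type*} [CommRing k] {Γ : Type*} [Group Γ]

/-- The coefficient of a central element on a conjugacy class. -/
def classCoeff (c : ConjClasses Γ) : GroupCenter k Γ →ₗ[k] k where
  toFun z := (z : MonoidAlgebra k Γ).coeff (Quotient.out c)
  map_add' _ _ := rfl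
  map_smul' _ _ := rfl

theorem mk_out (c : ConjClasses Γ) : ConjClasses.mk (Quotient.out c) = c := Quotient.out_eq c

theorem coeff_eq_classCoeff (z : GroupCenter k Γ) (g : Γ) :
    (z : MonoidAlgebra k Γ).coeff g = classCoeff (ConjClasses.mk g) z := by
  obtain ⟨h, hh⟩ := isConj_iff.1 (ConjClasses.mk_eq_mk_iff_isConj.1 (mk_out (ConjClasses.mk g)))
  -- With `r` the representative and `h r h⁻¹ = g`, the coefficients of `z h` and `h z` at `h r` are
  -- those of `z` at `g` and at `r`.
  have hz := Subalgebra.mem_center_iff.1 z.2 (MonoidAlgebra.single h 1)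
  have := congrArg (fun x => x.coeff (h * Quotient.out (ConjClasses.mk g))) hz
  simp only [MonoidAlgebra.coeff_single_mul_apply, MonoidAlgebra.coeff_mul_single_apply, hh] at this
  change _ = (z : MonoidAlgebra k Γ).coeff (Quotient.out (ConjClasses.mk g))
  simpa using this.symm

variable [Fintype Γ]

theorem coeff_rawClassSum (c : ConjClasses Γ) (g : Γ) :
    (rawClassSum k c).coeff g = if ConjClasses.mk g = c then 1 else 0 := by
  rw [rawClassSum, MonoidAlgebra.coeff_sum, Finset.sum_apply']
  simp only [MonoidAlgebra.of_apply, MonoidAlgebra.coeff_single]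
  by_cases h : ConjClasses.mk g = c
  · rw [if_pos h, Finset.sum_eq_single g]
    · simp
    · intro b _ hb
      rw [Finsupp.single_apply, if_neg hb]
    · intro hg
      exact absurd (by simpa using h) hg
  · rw [if_neg h]
    refine Finset.sum_eq_zero fun b hb => ?_
    rw [Finsupp.single_apply, if_neg]
    rintro rfl
    exact h (by simpa using hb)

theorem classCoeff_classSum (c d : ConjClasses Γ) :
    classCoeff d (classSum k c) = if d = c then 1 else 0 := by
  change (rawClassSum k c).coeff _ = _
  rw [coeff_rawClassSum, mk_out]

omit [Fintype Γ] in
theorem ext_classCoeff {z w : GroupCenter k Γ} (h : ∀ c, classCoeff c z = classCoeff c w) :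
    z = w := by
  refine Subtype.ext (MonoidAlgebra.ext (Finsupp.ext fun g => ?_))
  rw [coeff_eq_classCoeff, coeff_eq_classCoeff, h]

theorem sum_classCoeff_smul (z : GroupCenter k Γ) :
    ∑ c, classCoeff c z • classSum k c = z := by
  refine ext_classCoeff fun d => ?_
  rw [map_sum, Finset.sum_eq_single d]
  · simp [classCoeff_classSum]
  · intro b _ hb
    simp [classCoeff_classSum, hb.symm]
  · simp

/-- The structure constants of the class sums. -/
def classConst (c d e : ConjClasses Γ) : ℤ := classCoeff e (classSum ℤ c * classSum ℤ d)

theorem classSum_mul (c d : ConjClasses Γ) :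
    classSum k c * classSum k d = ∑ e, (classConst c d e : GroupCenter k Γ) * classSum k e := by
  have hmap : ∀ c : ConjClasses Γ, MonoidAlgebra.mapRingHom Γ (Int.castRingHom k)
      (rawClassSum ℤ c) = rawClassSum k c := fun c => by
    simp [rawClassSum, map_sum]
  refine ext_classCoeff fun e => ?_
  have h2 : ∀ e' : ConjClasses Γ, (classConst c d e' : GroupCenter k Γ) * classSum k e' =
      (classConst c d e' : k) • classSum k e' := fun e' => by
    rw [Int.cast_smul_eq_zsmul, zsmul_eq_mul]
  simp only [h2]
  rw [map_sum, Finset.sum_eq_single e]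
  · rw [map_smul, classCoeff_classSum, if_pos rfl, smul_eq_mul, mul_one]
    change (rawClassSum k c * rawClassSum k d).coeff _ =
      (((rawClassSum ℤ c * rawClassSum ℤ d).coeff (Quotient.out e) : ℤ) : k)
    rw [← hmap, ← hmap, ← map_mul, MonoidAlgebra.coeff_mapRingHom]
    rfl
  · intro b _ hb
    simp [classCoeff_classSum, hb.symm]
  · simp

end ClassSums

/-! ### Linear independence of the coefficients of an exponential. -/

section LinearIndependence

variable {σ : Type*}

open MvPolynomial (IsHomogeneous)

theorem isHomogeneous_coeff_pow {Y : MvPowerSeries σ (MvPolynomial σ ℚ)}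
    (hY : ∀ N, (coeff N Y).IsHomogeneous 1) (k : ℕ) (N : σ →₀ ℕ) :
    (coeff N (Y ^ k)).IsHomogeneous k := by
  induction k generalizing N with
  | zero =>
    rw [pow_zero, coeff_one]
    split_ifs
    · exact MvPolynomial.isHomogeneous_one _ _
    · exact MvPolynomial.isHomogeneous_zero _ _ _
  | succ k ih =>
    rw [pow_succ, coeff_mul]
    exact MvPolynomial.IsHomogeneous.sum _ _ _ fun x _ => (ih x.1).mul (hY x.2)

/-- The lowest possible degree of an `n`-th power is `n`, and that part depends only on the linear
part of the base. -/
theorem EqUpTo.pow_of_linear {R : Type*} [CommRing R] {Y Z : MvPowerSeries σ R}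
    (hY : constantCoeff Y = 0) (hZ : constantCoeff Z = 0) (h : EqUpTo 1 Y Z) (n : ℕ) :
    EqUpTo n (Y ^ n) (Z ^ n) := by
  induction n with
  | zero => simpa using EqUpTo.refl _
  | succ n ih =>
    intro N hN
    rw [pow_succ, pow_succ, coeff_mul, coeff_mul]
    refine Finset.sum_congr rfl fun x hx => ?_
    have hx' : x.1.degree + x.2.degree = N.degree := by
      rw [← map_add, Finset.HasAntidiagonal.mem_antidiagonal.1 hx]
    rcases lt_trichotomy x.1.degree n with h1 | h1 | h1
    · rw [EqUpTo.pow_zero_of_lt hY h1 x.1 le_rfl, EqUpTo.pow_zero_of_lt hZ h1 x.1 le_rfl,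
        map_zero, zero_mul, zero_mul]
    · rw [ih x.1 h1.le, h x.2 (by omega)]
    · have h2 : x.2 = 0 := (Finsupp.degree_eq_zero_iff _).1 (by omega)
      rw [h2, coeff_zero_eq_constantCoeff_apply, coeff_zero_eq_constantCoeff_apply, hY, hZ,
        mul_zero, mul_zero]

variable [Fintype σ]

theorem prod_C_X_mul_X_pow (m : σ → ℕ) :
    ∏ c, (C (MvPolynomial.X c) * X c : MvPowerSeries σ (MvPolynomial σ ℚ)) ^ m c =
      monomial (Finsupp.equivFunOnFinite.symm m)
        (MvPolynomial.monomial (Finsupp.equivFunOnFinite.symm m) 1) := by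
  simp only [mul_pow, Finset.prod_mul_distrib, ← map_pow, ← map_prod]
  have h1 : (∏ c, (X c : MvPowerSeries σ (MvPolynomial σ ℚ)) ^ m c) =
      monomial (Finsupp.equivFunOnFinite.symm m) 1 := by
    rw [MvPowerSeries.monomial_one_eq, Finsupp.prod_fintype _ _ (by simp)]
    rfl
  have h2 : (∏ c, (MvPolynomial.X c : MvPolynomial σ ℚ) ^ m c) =
      MvPolynomial.monomial (Finsupp.equivFunOnFinite.symm m) 1 := by
    rw [MvPolynomial.monomial_eq, Finsupp.prod_fintype _ _ (by simp)]
    simp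
  rw [h1, h2, ← monomial_zero_eq_C_apply, monomial_mul_monomial, zero_add, mul_one]

theorem coeff_sum_C_X_mul_X_pow (N M : σ →₀ ℕ) :
    MvPolynomial.coeff M (coeff N
      ((∑ c, C (MvPolynomial.X c) * X c : MvPowerSeries σ (MvPolynomial σ ℚ)) ^ N.degree)) =
      if M = N then (Nat.multinomial Finset.univ N : ℚ) else 0 := by
  rw [Finset.sum_pow_eq_sum_piAntidiag, map_sum, Finset.sum_eq_single (N : σ → ℕ)]
  · rw [prod_C_X_mul_X_pow, ← nsmul_eq_mul, map_nsmul]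
    have : Finsupp.equivFunOnFinite.symm (N : σ → ℕ) = N := by ext; simp
    rw [this, coeff_monomial_same, MvPolynomial.coeff_smul, MvPolynomial.coeff_monomial]
    by_cases h : N = M
    · rw [if_pos h, if_pos h.symm]; simp
    · rw [if_neg h, if_neg (Ne.symm h)]; simp
  · intro m _ hm
    rw [prod_C_X_mul_X_pow, ← nsmul_eq_mul, map_nsmul, coeff_monomial_ne, smul_zero]
    rintro rfl
    exact hm (by ext; simp)
  · intro h
    refine absurd ?_ h
    rw [Finset.mem_piAntidiag]
    exact ⟨(Finsupp.degree_eq_sum N).symm, fun _ _ => Finset.mem_univ _⟩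

/-- Triangularity by polynomial degree. In the coefficient of `x ^ N`, the term `Y ^ k / k!`
contributes a homogeneous polynomial of degree `k ≤ |N|`. The top part `k = |N|` comes from the
linear part `∑ X_c x_c` of `Y`, and is a positive multiple of the monomial `X ^ N`. -/
theorem linearIndependent_coeff_formalExp {Y : MvPowerSeries σ (MvPolynomial σ ℚ)}
    (hY : ∀ N, (coeff N Y).IsHomogeneous 1) (hY0 : constantCoeff Y = 0)
    (hY1 : ∀ c, coeff (Finsupp.single c 1) Y = MvPolynomial.X c) :
    LinearIndependent ℚ fun N => coeff N (formalExp Y) := by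
  have hlin : EqUpTo 1 Y (∑ c, C (MvPolynomial.X c) * X c) := by
    intro N hN
    rcases Nat.le_one_iff_eq_zero_or_eq_one.1 hN with h | h
    · rw [(Finsupp.degree_eq_zero_iff _).1 h, coeff_zero_eq_constantCoeff_apply,
        coeff_zero_eq_constantCoeff_apply, hY0]
      simp
    · have : N ∈ Set.range fun c : σ => Finsupp.single c 1 := by
        rw [Finsupp.range_single_one]; exact h
      obtain ⟨c, rfl⟩ := this
      beta_reduce
      rw [hY1, map_sum, Finset.sum_eq_single c]
      · rw [coeff_C_mul, coeff_X, if_pos rfl, mul_one]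
      · intro d _ hd
        rw [coeff_C_mul, coeff_X, if_neg, mul_zero]
        intro h
        exact hd (Finsupp.single_left_injective one_ne_zero h).symm
      · simp
  have hcoeff : ∀ N M : σ →₀ ℕ, N.degree ≤ M.degree →
      MvPolynomial.coeff M (coeff N (formalExp Y)) =
      if M = N then ((N.degree.factorial : ℚ)⁻¹) * (Nat.multinomial Finset.univ N : ℚ) else 0 := by
    intro N M hNM
    rw [formalExp_eqUpTo hY0 N.degree N le_rfl, map_sum, MvPolynomial.coeff_sum,
      Finset.sum_eq_single N.degree]
    · rw [show coeff N ((N.degree.factorial : ℚ)⁻¹ • Y ^ N.degree) =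
        (N.degree.factorial : ℚ)⁻¹ • coeff N (Y ^ N.degree) from rfl, MvPolynomial.coeff_smul,
        EqUpTo.pow_of_linear hY0 (by simp) hlin N.degree N le_rfl, coeff_sum_C_X_mul_X_pow,
        smul_eq_mul, mul_ite, mul_zero]
    · intro k hk hkN
      rw [Finset.mem_range] at hk
      rw [show coeff N ((k.factorial : ℚ)⁻¹ • Y ^ k) =
        (k.factorial : ℚ)⁻¹ • coeff N (Y ^ k) from rfl, MvPolynomial.coeff_smul,
        (isHomogeneous_coeff_pow hY k N).coeff_eq_zero, smul_zero]
      omega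
    · simp
  rw [linearIndependent_iff]
  intro l hl
  by_contra hne
  -- Maximality of `|N|` puts every other term of the relation within the range of `hcoeff`, so none
  -- of them involves the monomial `X ^ N`.
  obtain ⟨N, hN, hmax⟩ := l.support.exists_max_image Finsupp.degree
    (Finsupp.support_nonempty_iff.2 hne)
  have h := congrArg (MvPolynomial.coeff N) hl
  rw [Finsupp.linearCombination_apply, Finsupp.sum, MvPolynomial.coeff_sum,
    Finset.sum_eq_single N] at h
  · rw [MvPolynomial.coeff_smul, hcoeff N N le_rfl, if_pos rfl, MvPolynomial.coeff_zero,
      smul_eq_mul] at h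
    have h1 : (0 : ℚ) < (N.degree.factorial : ℚ)⁻¹ * (Nat.multinomial Finset.univ N : ℚ) := by
      have : 0 < Nat.multinomial Finset.univ N := Nat.multinomial_pos _ _
      positivity
    exact (Finsupp.mem_support_iff.1 hN) ((mul_eq_zero.1 h).resolve_right h1.ne')
  · intro M hM hMN
    rw [MvPolynomial.coeff_smul, hcoeff M N (hmax M hM), if_neg (Ne.symm hMN), smul_zero]
  · exact fun h' => absurd hN h'

end LinearIndependence

end

end WeightedIVP

namespace WeightedIVP

open MvPowerSeries

noncomputable section

open scoped Classical

/-! ### The enveloping algebra of `Z(ℚΓ)` and the multiplication and independence of the `B_N`. -/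

section Env

attribute [local instance 100] LieRing.ofAssociativeRing

variable {Γ : Type*} [Group Γ]

theorem lie_groupCenter (x y : GroupCenter ℚ Γ) : ⁅x, y⁆ = 0 := by
  have h : ⁅x, y⁆ = x * y - y * x := rfl
  rw [h, mul_comm, sub_self]

/-- The images of `𝔤` commute because the bracket of `𝔤` vanishes, and they generate the enveloping
algebra. -/
theorem env_mul_comm (x y : Env Γ) : x * y = y * x := by
  have hι : ∀ a b : GroupCenter ℚ Γ, Commute (envι Γ a) (envι Γ b) := fun a b => by
    have h := LieHom.map_lie (UniversalEnvelopingAlgebra.ι ℚ : GroupCenter ℚ Γ →ₗ⁅ℚ⁆ Env Γ) a b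
    rw [lie_groupCenter, map_zero, LieRing.of_associative_ring_bracket] at h
    exact (sub_eq_zero.1 h.symm)
  have htop : Algebra.adjoin ℚ (Set.range (envι Γ)) = (⊤ : Subalgebra ℚ (Env Γ)) := by
    let S : Subalgebra ℚ (Env Γ) := Algebra.adjoin ℚ (Set.range (envι Γ))
    let f : GroupCenter ℚ Γ →ₗ⁅ℚ⁆ S :=
      { toLinearMap := (envι Γ).codRestrict (Subalgebra.toSubmodule S)
          fun a => Algebra.subset_adjoin ⟨a, rfl⟩
        map_lie' := fun {a b} => by
          rw [lie_groupCenter, LieRing.of_associative_ring_bracket]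
          apply Subtype.ext
          change envι Γ 0 = envι Γ a * envι Γ b - envι Γ b * envι Γ a
          rw [map_zero, hι a b, sub_self] }
    -- By the universal property the identity factors through the subalgebra `S` generated by `𝔤`,
    -- hence `S` is everything.
    have hid : S.val.comp (UniversalEnvelopingAlgebra.lift ℚ f) = AlgHom.id ℚ (Env Γ) := by
      refine UniversalEnvelopingAlgebra.hom_ext ℚ ?_
      ext a
      change ((UniversalEnvelopingAlgebra.lift ℚ f (UniversalEnvelopingAlgebra.ι ℚ a) : S) : Env Γ)
        = _
      rw [UniversalEnvelopingAlgebra.lift_ι_apply]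
      rfl
    rw [eq_top_iff]
    intro z _
    have := DFunLike.congr_fun hid z
    rw [← show _ = z from this]
    exact (UniversalEnvelopingAlgebra.lift ℚ f z).2
  have hcomm : ∀ z : Env Γ, z ∈ Algebra.adjoin ℚ (Set.range (envι Γ)) := fun z => by
    rw [htop]; trivial
  refine Algebra.adjoin_induction₂ (p := fun x y _ _ => x * y = y * x) ?_ ?_ ?_ ?_ ?_ ?_ ?_ ?_
    (hcomm x) (hcomm y)
  · rintro _ _ ⟨a, rfl⟩ ⟨b, rfl⟩
    exact hι a b
  · intro r s
    rw [← map_mul, ← map_mul, mul_comm]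
  · intro r z _
    exact Algebra.commutes r z
  · intro r z _
    exact (Algebra.commutes r z).symm
  · intro x y z _ _ _ h1 h2
    rw [add_mul, mul_add, h1, h2]
  · intro x y z _ _ _ h1 h2
    rw [add_mul, mul_add, h1, h2]
  · intro x y z _ _ _ h1 h2
    rw [mul_assoc, h2, ← mul_assoc, h1, mul_assoc]
  · intro x y z _ _ _ h1 h2
    rw [← mul_assoc, h1, mul_assoc, h2, mul_assoc]

/-- The enveloping algebra of the abelian Lie algebra `Z(ℚΓ)` is commutative. -/
abbrev envCommRing : CommRing (Env Γ) :=
  { (inferInstance : Ring (Env Γ)) with mul_comm := env_mul_comm }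

attribute [local instance] envCommRing

variable [Fintype Γ]

theorem genericElt_eq : genericElt Γ = genericForm (classSum ℚ (Γ := Γ)) := by
  rw [genericElt, genericForm]
  refine Finset.sum_congr rfl fun c _ => ?_
  rw [X, ← monomial_zero_eq_C_apply, monomial_mul_monomial, zero_add, mul_one]

theorem omega_eq_expLog :
    omega Γ = expLog (envι Γ) (genericForm (classSum ℚ (Γ := Γ))) := by
  rw [omega, genericElt_eq]
  rfl

theorem isMult_omega : IsMult classConst (omega Γ) := by
  rw [omega_eq_expLog]
  exact isMult_expLog_genericForm _ _ classSum_mul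

theorem coeffB_zero : coeffB (0 : ConjClasses Γ →₀ ℕ) = 1 :=
  isMult_omega.constantCoeff_eq

theorem coeffB_mul (N M : ConjClasses Γ →₀ ℕ) :
    coeffB N * coeffB M = ∑ L ∈ exponentsLE (ConjClasses Γ) (N.degree + M.degree),
      structConst classConst N M L • coeffB L := by
  have h := (isMult_iff.1 (isMult_omega (Γ := Γ))).2 N M
  simp only [zsmul_eq_mul]
  exact h

/-- The map from the enveloping algebra of `Z(ℚΓ)` to polynomials in variables indexed by the
conjugacy classes that sends a class sum to the variable of its class. -/
def envToMvPolynomial : Env Γ →ₐ[ℚ] MvPolynomial (ConjClasses Γ) ℚ :=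
  UniversalEnvelopingAlgebra.lift ℚ
    { toFun := fun z => ∑ c, classCoeff c z • MvPolynomial.X c
      map_add' := fun x y => by simp [add_smul, Finset.sum_add_distrib]
      map_smul' := fun r x => by simp [mul_smul, Finset.smul_sum]
      map_lie' := fun {x y} => by
        rw [lie_groupCenter, LieRing.of_associative_ring_bracket, mul_comm, sub_self]
        simp }

theorem envToMvPolynomial_envι (z : GroupCenter ℚ Γ) :
    envToMvPolynomial (envι Γ z) = ∑ c, classCoeff c z • MvPolynomial.X c :=
  UniversalEnvelopingAlgebra.lift_ι_apply _ _ _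

theorem map_formalExp {σ A B : Type*} [CommRing A] [Algebra ℚ A] [CommRing B] [Algebra ℚ B]
    (φ : A →ₐ[ℚ] B) (f : MvPowerSeries σ A) :
    map φ.toRingHom (formalExp f) = formalExp (map φ.toRingHom f) := by
  ext N
  rw [coeff_map]
  change φ (∑ k ∈ Finset.range (N.degree + 1), ((k.factorial : ℚ)⁻¹) • coeff N (f ^ k)) =
    ∑ k ∈ Finset.range (N.degree + 1), ((k.factorial : ℚ)⁻¹) • coeff N (map φ.toRingHom f ^ k)
  rw [map_sum]
  refine Finset.sum_congr rfl fun k _ => ?_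
  rw [map_smul, ← map_pow, coeff_map]
  rfl

/-- Independence may be tested after an algebra map to a polynomial ring. There `T (log ...)` has
linear forms as coefficients, so the triangularity lemma applies. -/
theorem linearIndependent_coeffB : LinearIndependent ℚ (coeffB (Γ := Γ)) := by
  let Y : MvPowerSeries (ConjClasses Γ) (MvPolynomial (ConjClasses Γ) ℚ) :=
    map envToMvPolynomial.toRingHom (mapCoeff (envι Γ) (formalLogOneAdd (genericElt Γ)))
  have hY : ∀ N, coeff N Y =
      ∑ c, classCoeff c (coeff N (formalLogOneAdd (genericElt Γ))) • MvPolynomial.X c :=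
    fun N => envToMvPolynomial_envι _
  have h : LinearIndependent ℚ fun N => coeff N (formalExp Y) := by
    refine linearIndependent_coeff_formalExp (fun N => ?_) ?_ fun c => ?_
    · rw [hY]
      refine MvPolynomial.IsHomogeneous.sum _ _ _ fun c _ => ?_
      rw [MvPolynomial.smul_eq_C_mul]
      exact (MvPolynomial.isHomogeneous_X _ _).C_mul _
    · have h0 : coeff 0 (formalLogOneAdd (genericElt Γ)) = 0 :=
        constantCoeff_formalLogOneAdd (genericElt Γ)
      rw [← coeff_zero_eq_constantCoeff_apply, hY, h0]
      simp
    · have h1 : coeff (Finsupp.single c 1) (formalLogOneAdd (genericElt Γ)) = classSum ℚ c := by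
        rw [← coeff_genericElt]
        simp [formalLogOneAdd, coeff_apply]
      rw [hY, h1, Finset.sum_eq_single c]
      · simp [classCoeff_classSum]
      · intro b _ hb
        simp [classCoeff_classSum, hb]
      · simp
  refine LinearIndependent.of_comp envToMvPolynomial.toLinearMap ?_
  have heq : (envToMvPolynomial.toLinearMap ∘ coeffB (Γ := Γ)) = fun N => coeff N (formalExp Y) := by
    funext N
    exact congrArg (coeff N) (map_formalExp envToMvPolynomial _)
  rw [heq]
  exact h

end Env

/-! ### The `ℤ`-basis of `R_Γ`, and homomorphisms as multiplicative series. -/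

section RGammaBasis

variable {Γ : Type*} [Group Γ] [Fintype Γ]

theorem coe_RGamma : (RGamma Γ : Set (Env Γ)) = rGammaSpan Γ := by
  have hmul : ∀ x ∈ rGammaSpan Γ, ∀ y ∈ rGammaSpan Γ, x * y ∈ rGammaSpan Γ := by
    intro x hx y hy
    induction hx, hy using Submodule.span_induction₂ with
    | mem_mem x y hx hy =>
      obtain ⟨N, rfl⟩ := hx
      obtain ⟨M, rfl⟩ := hy
      rw [coeffB_mul]
      exact Submodule.sum_mem _ fun L _ => Submodule.smul_mem _ _ (Submodule.subset_span ⟨L, rfl⟩)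
    | zero_left y _ => rw [zero_mul]; exact Submodule.zero_mem _
    | zero_right x _ => rw [mul_zero]; exact Submodule.zero_mem _
    | add_left x y z _ _ _ h1 h2 => rw [add_mul]; exact Submodule.add_mem _ h1 h2
    | add_right x y z _ _ _ h1 h2 => rw [mul_add]; exact Submodule.add_mem _ h1 h2
    | smul_left r x y _ _ h => rw [smul_mul_assoc]; exact Submodule.smul_mem _ _ h
    | smul_right r x y _ _ h => rw [mul_smul_comm]; exact Submodule.smul_mem _ _ h
  let S : Subring (Env Γ) :=
    { carrier := rGammaSpan Γ
      mul_mem' := fun {x y} hx hy => hmul x hx y hy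
      one_mem' := Submodule.subset_span ⟨0, coeffB_zero⟩
      add_mem' := fun {x y} hx hy => Submodule.add_mem _ hx hy
      zero_mem' := Submodule.zero_mem _
      neg_mem' := fun {x} hx => Submodule.neg_mem _ hx }
  refine Set.Subset.antisymm ?_ Subring.subset_closure
  exact (Subring.closure_le (t := S)).2 (fun x hx => hx)

/-- The `B_N` form a basis of `R_Γ` over `ℤ`. -/
def basisB : Module.Basis (ConjClasses Γ →₀ ℕ) ℤ (RGamma Γ) :=
  Module.Basis.mk (v := elemB) (by
      have h : LinearIndependent ℤ (coeffB (Γ := Γ)) :=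
        linearIndependent_coeffB.restrict_scalars' ℤ
      exact LinearIndependent.of_comp (RGamma Γ).subtype.toAddMonoidHom.toIntLinearMap h) (by
    rintro ⟨x, hx⟩ -
    have hx' : x ∈ rGammaSpan Γ := by
      have h : x ∈ (RGamma Γ : Set (Env Γ)) := hx
      rwa [coe_RGamma] at h
    have h2 : rGammaSpan Γ = (Submodule.span ℤ (Set.range (elemB (Γ := Γ)))).map
        (RGamma Γ).subtype.toAddMonoidHom.toIntLinearMap := by
      rw [Submodule.map_span, ← Set.range_comp]
      rfl
    rw [h2] at hx'
    obtain ⟨y, hy, hyx⟩ := hx'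
    have : y = ⟨x, hx⟩ := Subtype.ext hyx
    rwa [← this])

theorem basisB_apply (N : ConjClasses Γ →₀ ℕ) : basisB N = elemB N := by
  rw [basisB, Module.Basis.mk_apply]

theorem elemB_zero : elemB (0 : ConjClasses Γ →₀ ℕ) = 1 := Subtype.ext coeffB_zero

theorem elemB_mul (N M : ConjClasses Γ →₀ ℕ) :
    elemB N * elemB M = ∑ L ∈ exponentsLE (ConjClasses Γ) (N.degree + M.degree),
      structConst classConst N M L • elemB L := by
  refine Subtype.ext ?_
  have h := map_sum (RGamma Γ).subtype
    (fun L => structConst classConst N M L • elemB (Γ := Γ) L)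
    (exponentsLE (ConjClasses Γ) (N.degree + M.degree))
  refine Eq.trans (coeffB_mul N M) (Eq.trans ?_ h.symm)
  refine Finset.sum_congr rfl fun L _ => ?_
  rw [map_zsmul]
  rfl

variable {F : Type*} [Field F]

theorem coeff_genFun (φ : RGamma Γ →+* F) (N : ConjClasses Γ →₀ ℕ) :
    coeff N (genFun φ) = φ (elemB N) := rfl

theorem genFun_injective : Function.Injective (genFun : (RGamma Γ →+* F) → _) := by
  intro φ ψ h
  have h' : φ.toAddMonoidHom.toIntLinearMap = ψ.toAddMonoidHom.toIntLinearMap :=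
    basisB.ext fun N => by
      rw [basisB_apply]
      exact congrArg (coeff N) h
  exact RingHom.ext fun x => LinearMap.congr_fun h' x

theorem isMult_genFun (φ : RGamma Γ →+* F) : IsMult classConst (genFun φ) := by
  rw [isMult_iff]
  refine ⟨?_, fun N M => ?_⟩
  · rw [← coeff_zero_eq_constantCoeff_apply, coeff_genFun, elemB_zero, map_one]
  · simp only [coeff_genFun]
    rw [← map_mul, elemB_mul, map_sum]
    simp

/-- Prescribing the values on the basis `B_N` gives an additive map. It is multiplicative on basis
elements by `isMult_iff`, since the `B_N` and the coefficients of `G` have the same multiplication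
table. -/
theorem exists_genFun_eq {G : MvPowerSeries (ConjClasses Γ) F} (hG : IsMult classConst G) :
    ∃ φ : RGamma Γ →+* F, genFun φ = G := by
  let f : RGamma Γ →ₗ[ℤ] F := basisB.constr ℤ fun N => coeff N G
  have hf : ∀ N, f (elemB N) = coeff N G := fun N => by
    rw [← basisB_apply, Module.Basis.constr_basis]
  rw [isMult_iff] at hG
  have hmul : ∀ x y, f (x * y) = f x * f y := by
    have h : (LinearMap.mul ℤ (RGamma Γ)).compr₂ f = (LinearMap.mul ℤ F).compl₁₂ f f := by
      refine basisB.ext fun N => basisB.ext fun M => ?_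
      simp only [basisB_apply, LinearMap.compr₂_apply, LinearMap.compl₁₂_apply,
        LinearMap.mul_apply']
      rw [elemB_mul, map_sum, hf, hf, hG.2]
      exact Finset.sum_congr rfl fun L _ => by rw [map_zsmul, hf, zsmul_eq_mul]
    exact fun x y => LinearMap.congr_fun₂ h x y
  have hone : f 1 = 1 := by
    rw [← elemB_zero, hf, coeff_zero_eq_constantCoeff_apply, hG.1]
  exact ⟨RingHom.mk ⟨⟨f, hone⟩, hmul⟩ (map_zero f) (map_add f), MvPowerSeries.ext hf⟩

end RGammaBasis

end

end WeightedIVP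

namespace WeightedIVP

open MvPowerSeries

noncomputable section

/-! ### Powers with `p`-adic exponents. -/

section PadicPowers

variable {p : ℕ} [Fact p.Prime] {F : Type*} [Field F] [CharP F p]

theorem padicToField_eq_of_norm_sub_lt_one {x y : ℤ_[p]} (h : ‖x - y‖ < 1) :
    padicToField p F x = padicToField p F y := by
  have h1 : x - y ∈ RingHom.ker (PadicInt.toZMod (p := p)) := by
    rw [PadicInt.ker_toZMod, IsLocalRing.mem_maximalIdeal]
    exact PadicInt.mem_nonunits.2 h
  have h2 := RingHom.sub_mem_ker_iff _ |>.1 h1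
  rw [padicToField, RingHom.comp_apply, RingHom.comp_apply, h2]

theorem isOpen_preimage_padicToField (s : Set F) : IsOpen (padicToField p F ⁻¹' s) := by
  rw [Metric.isOpen_iff]
  refine fun x hx => ⟨1, one_pos, fun y hy => ?_⟩
  rw [Metric.mem_ball, dist_eq_norm] at hy
  rwa [Set.mem_preimage, padicToField_eq_of_norm_sub_lt_one hy]

/-- The binomial coefficient `(t choose r)` in `F`. -/
def binom (F : Type*) [Field F] [CharP F p] (t : ℤ_[p]) (r : ℕ) : F :=
  padicToField p F (Ring.choose t r)

theorem binom_natCast (m r : ℕ) : binom F (m : ℤ_[p]) r = (m.choose r : F) := by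
  rw [binom, Ring.choose_natCast, map_natCast]

theorem isOpen_binom_preimage (r : ℕ) (s : Set F) : IsOpen {t : ℤ_[p] | binom F t r ∈ s} :=
  (isOpen_preimage_padicToField s).preimage (PadicInt.continuous_choose r)

/-- Binomial coefficients are continuous on `ℤ_p`, reduction modulo `p` is locally constant, and `ℕ`
is dense. Thus up to any given degree `(1 + f) ^ t` is an ordinary power, and identities for
`p`-adic exponents follow from those for natural ones. -/
theorem exists_nat_binom_eq (F : Type*) [Field F] [CharP F p] (t : ℤ_[p]) (n k : ℕ) :
    ∃ m : ℕ, PadicInt.toZModPow k t = PadicInt.toZModPow k (m : ℤ_[p]) ∧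
      ∀ r ≤ n, binom F t r = (m.choose r : F) := by
  have ho : IsOpen (Metric.ball t ((p : ℝ) ^ (-k : ℤ)) ∩
      ⋂ r ∈ Set.Iic n, {s : ℤ_[p] | binom F s r ∈ ({binom F t r} : Set F)}) :=
    Metric.isOpen_ball.inter ((Set.finite_Iic n).isOpen_biInter
      fun r _ => isOpen_binom_preimage r _)
  have hp : (0 : ℝ) < p := by exact_mod_cast (Fact.out : p.Prime).pos
  obtain ⟨m, hm⟩ := PadicInt.denseRange_natCast.exists_mem_open ho
    ⟨t, Metric.mem_ball_self (by positivity), by simp⟩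
  refine ⟨m, ?_, fun r hr => ?_⟩
  · have h := hm.1
    rw [Metric.mem_ball, dist_comm, dist_eq_norm] at h
    have h1 := (PadicInt.norm_le_pow_iff_mem_span_pow (t - (m : ℤ_[p])) k).1 h.le
    rw [← PadicInt.ker_toZModPow] at h1
    exact RingHom.sub_mem_ker_iff _ |>.1 h1
  · have h := Set.mem_iInter₂.1 hm.2 r hr
    rw [← binom_natCast (p := p)]
    exact (Set.mem_singleton_iff.1 h).symm

variable {σ τ : Type*}

theorem oneAddPow_eqUpTo {f : MvPowerSeries σ F} (hf : constantCoeff f = 0) (t : ℤ_[p]) (n : ℕ) :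
    EqUpTo n (oneAddPow f t) (∑ r ∈ Finset.range (n + 1), C (binom F t r) * f ^ r) := by
  intro N hN
  rw [map_sum]
  change ∑ r ∈ Finset.range (N.degree + 1), binom F t r * coeff N (f ^ r) = _
  simp only [coeff_C_mul]
  refine Finset.sum_subset (Finset.range_subset_range.2 (by omega)) fun k _ hk => ?_
  rw [Finset.mem_range, not_lt] at hk
  rw [EqUpTo.pow_zero_of_lt hf hk N le_rfl, map_zero, mul_zero]

theorem oneAddPow_eqUpTo_pow {f : MvPowerSeries σ F} (hf : constantCoeff f = 0) {t : ℤ_[p]}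
    {n m : ℕ} (h : ∀ r ≤ n, binom F t r = (m.choose r : F)) :
    EqUpTo n (oneAddPow f t) ((1 + f) ^ m) := by
  refine (oneAddPow_eqUpTo hf t n).trans ?_
  have h1 : (∑ r ∈ Finset.range (n + 1), C (binom F t r) * f ^ r) =
      ∑ r ∈ Finset.range (n + 1), C (m.choose r : F) * f ^ r :=
    Finset.sum_congr rfl fun r hr => by rw [h r (by simpa [Nat.lt_succ_iff] using hr)]
  have h2 : (1 + f) ^ m = ∑ r ∈ Finset.range (n + m + 1), C (m.choose r : F) * f ^ r := by
    rw [add_comm 1 f, add_pow]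
    refine Finset.sum_subset_zero_on_sdiff (Finset.range_subset_range.2 (by omega))
      (fun r hr => ?_) fun r _ => ?_
    · rw [Finset.mem_sdiff, Finset.mem_range, Finset.mem_range] at hr
      rw [Nat.choose_eq_zero_of_lt (by omega)]
      simp
    · rw [one_pow, mul_one, map_natCast, mul_comm]
  rw [h1, h2]
  intro N hN
  rw [map_sum, map_sum]
  refine Finset.sum_subset (Finset.range_subset_range.2 (by omega)) fun k _ hk => ?_
  rw [Finset.mem_range, not_lt] at hk
  rw [coeff_C_mul, EqUpTo.pow_zero_of_lt hf hk N hN, map_zero, mul_zero]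

theorem constantCoeff_oneAddPow (f : MvPowerSeries σ F) (t : ℤ_[p]) :
    constantCoeff (oneAddPow f t) = 1 := by
  rw [← coeff_zero_eq_constantCoeff_apply, coeff_apply]
  simp [oneAddPow]

theorem coeff_single_oneAddPow (f : MvPowerSeries σ F) (t : ℤ_[p]) (c : σ) :
    coeff (Finsupp.single c 1) (oneAddPow f t) =
      padicToField p F t * coeff (Finsupp.single c 1) f := by
  classical
  have h3 : coeff (Finsupp.single c 1) (1 : MvPowerSeries σ F) = 0 := by
    rw [coeff_one, if_neg (by simp)]
  rw [coeff_apply]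
  simp [oneAddPow, Finset.sum_range_succ, h3]

theorem oneAddPow_mul {f g : MvPowerSeries σ F} (hf : constantCoeff f = 0)
    (hg : constantCoeff g = 0) (t : ℤ_[p]) :
    oneAddPow f t * oneAddPow g t = oneAddPow (f + g + f * g) t := by
  refine EqUpTo.ext fun n => ?_
  obtain ⟨m, -, hm⟩ := exists_nat_binom_eq F t n 0
  refine ((oneAddPow_eqUpTo_pow hf hm).mul (oneAddPow_eqUpTo_pow hg hm)).trans ?_
  rw [← mul_pow, show (1 + f) * (1 + g) = 1 + (f + g + f * g) by ring]
  exact (oneAddPow_eqUpTo_pow (by simp [hf, hg]) hm).symm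

/-- For a natural exponent `m` this is `(1 + f ^ q) ^ m = ((1 + f) ^ q) ^ m` with `q = p ^ k`, in
characteristic `p`. -/
theorem oneAddPow_pow_char {f : MvPowerSeries σ F} (hf : constantCoeff f = 0) (t : ℤ_[p])
    (k : ℕ) : oneAddPow (f ^ p ^ k) t = oneAddPow f t ^ p ^ k := by
  have hp : p ^ k ≠ 0 := pow_ne_zero _ (Fact.out : p.Prime).ne_zero
  have : CharP (MvPowerSeries σ F) p := charP_of_injective_ringHom (C_injective (σ := σ)) p
  refine EqUpTo.ext fun n => ?_
  obtain ⟨m, -, hm⟩ := exists_nat_binom_eq F t n 0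
  refine (oneAddPow_eqUpTo_pow (by rw [map_pow, hf, zero_pow hp]) hm).trans ?_
  have h := EqUpTo.prod (Finset.range (p ^ k)) (fun i _ => oneAddPow_eqUpTo_pow hf hm)
  rw [Finset.prod_const, Finset.prod_const, Finset.card_range] at h
  refine EqUpTo.trans ?_ h.symm
  rw [← pow_mul, mul_comm m, pow_mul, add_pow_char_pow, one_pow]
  exact EqUpTo.refl _

theorem subst_oneAddPow [Finite σ] {a : σ → MvPowerSeries τ F}
    (ha : ∀ s, constantCoeff (a s) = 0) {f : MvPowerSeries σ F} (hf : constantCoeff f = 0)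
    (t : ℤ_[p]) : subst a (oneAddPow f t) = oneAddPow (subst a f) t := by
  refine EqUpTo.ext fun n => ?_
  obtain ⟨m, -, hm⟩ := exists_nat_binom_eq F t n 0
  refine ((oneAddPow_eqUpTo_pow hf hm).subst ha).trans ?_
  refine EqUpTo.trans ?_
    (oneAddPow_eqUpTo_pow (by simp [constantCoeff_subst_zero ha, hf]) hm).symm
  rw [← coe_substAlgHom (hasSubst_of_constantCoeff_zero ha), map_pow, map_add, map_one]
  exact EqUpTo.refl _

theorem coeff_oneAddPow_X (t : ℤ_[p]) (r : ℕ) :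
    PowerSeries.coeff r (oneAddPow (PowerSeries.X : PowerSeries F) t : PowerSeries F) =
      binom F t r := by
  have h := oneAddPow_eqUpTo (f := (PowerSeries.X : PowerSeries F))
    PowerSeries.constantCoeff_X t r (Finsupp.single () r) (by simp)
  rw [PowerSeries.coeff]
  refine h.trans ?_
  rw [map_sum, Finset.sum_eq_single r]
  · rw [coeff_C_mul]
    have := PowerSeries.coeff_X_pow_self (R := F) r
    rw [PowerSeries.coeff] at this
    rw [this, mul_one]
  · intro k _ hk
    rw [coeff_C_mul]
    have := PowerSeries.coeff_X_pow (R := F) r k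
    rw [PowerSeries.coeff, if_neg hk.symm] at this
    rw [this, mul_zero]
  · simp

end PadicPowers

/-! ### Endomorphisms of the formal multiplicative group in characteristic `p`. -/

section Characters

variable {F : Type*} [Field F]

/-- The sums are the coefficients of `∑ c_n (1 + X) ^ n`, the Taylor shift of `∑ c_n X ^ n`, and the
shift is injective. -/
theorem eq_zero_of_sum_mul_choose_eq_zero {q : ℕ} {c : ℕ → F}
    (h : ∀ i < q, ∑ n ∈ Finset.range q, c n * (n.choose i : F) = 0) :
    ∀ n < q, c n = 0 := by
  let R : Polynomial F := ∑ n ∈ Finset.range q, Polynomial.C (c n) * Polynomial.X ^ n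
  have hR : Polynomial.taylor 1 R = 0 := by
    ext i
    rw [map_sum, Polynomial.finsetSum_coeff, Polynomial.coeff_zero]
    simp only [Polynomial.taylor_mul, Polynomial.taylor_C, Polynomial.taylor_pow,
      Polynomial.taylor_X, Polynomial.coeff_C_mul, map_one, Polynomial.coeff_X_add_one_pow]
    rcases lt_or_ge i q with hi | hi
    · exact h i hi
    · refine Finset.sum_eq_zero fun n hn => ?_
      rw [Finset.mem_range] at hn
      rw [Nat.choose_eq_zero_of_lt (by omega), Nat.cast_zero, mul_zero]
  have hR0 : R = 0 := Polynomial.taylor_injective 1 (hR.trans (map_zero _).symm)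
  intro n hn
  have h1 := congrArg (fun P => P.coeff n) hR0
  simpa [R, Polynomial.finsetSum_coeff, Polynomial.coeff_X_pow, hn] using h1

theorem choose_injOn {q n n' : ℕ} (hn : n < q) (hn' : n' < q)
    (h : ∀ i < q, (n.choose i : F) = (n'.choose i : F)) : n = n' := by
  by_contra hne
  have := eq_zero_of_sum_mul_choose_eq_zero (F := F) (q := q)
    (c := fun m => (if m = n then 1 else 0) - (if m = n' then 1 else 0)) (fun i hi => by
      simp [sub_mul, Finset.sum_sub_distrib, hn, hn', h i hi]) n hn
  simp [hne] at this

variable {p : ℕ} [Fact p.Prime] [CharP F p]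

/-- Modulo `X ^ q` with `q = p ^ k`, the factor `(1 + X) ^ q = 1 + X ^ q` is `1`, so only `m` modulo
`q` matters. -/
theorem choose_mod_pow (m k : ℕ) {i : ℕ} (hi : i < p ^ k) :
    (m.choose i : F) = ((m % p ^ k).choose i : F) := by
  have hc : CharP (Polynomial F) p := inferInstance
  have h : (Polynomial.X + 1 : Polynomial F) ^ m =
      (Polynomial.X + 1) ^ (m % p ^ k) * (Polynomial.X ^ p ^ k + 1) ^ (m / p ^ k) := by
    conv_lhs => rw [← Nat.mod_add_div m (p ^ k), pow_add, pow_mul, add_pow_char_pow, one_pow]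
  have hdvd : (Polynomial.X : Polynomial F) ^ p ^ k ∣
      (Polynomial.X + 1 : Polynomial F) ^ m - (Polynomial.X + 1) ^ (m % p ^ k) := by
    rw [h, ← mul_sub_one]
    refine Dvd.dvd.mul_left ?_ _
    have := sub_dvd_pow_sub_pow ((Polynomial.X : Polynomial F) ^ p ^ k + 1) 1 (m / p ^ k)
    rwa [one_pow, add_sub_cancel_right] at this
  have h0 := Polynomial.X_pow_dvd_iff.1 hdvd i hi
  rw [Polynomial.coeff_sub, Polynomial.coeff_X_add_one_pow, Polynomial.coeff_X_add_one_pow] at h0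
  exact sub_eq_zero.1 h0

/-- The binomials with `r < p ^ k` already determine `t` modulo `p ^ k`: replace `t` by a natural
number congruent to it and use the independence of the `(1 + X) ^ n`, `n < p ^ k`. -/
theorem binom_injective {t t' : ℤ_[p]} (h : ∀ r, binom F t r = binom F t' r) : t = t' := by
  rw [← PadicInt.ext_of_toZModPow]
  intro k
  have hpk : 0 < p ^ k := pow_pos (Fact.out : p.Prime).pos k
  obtain ⟨m, h1, h2⟩ := exists_nat_binom_eq F t (p ^ k) k
  obtain ⟨m', h1', h2'⟩ := exists_nat_binom_eq F t' (p ^ k) k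
  have hmod : m % p ^ k = m' % p ^ k :=
    choose_injOn (F := F) (Nat.mod_lt _ hpk) (Nat.mod_lt _ hpk) fun i hi => by
      rw [← choose_mod_pow m k hi, ← choose_mod_pow m' k hi, ← h2 i hi.le, ← h2' i hi.le, h]
  rw [h1, h1', map_natCast, map_natCast]
  exact (ZMod.natCast_eq_natCast_iff _ _ _).2 hmod

/-- Modulo `X ^ q`, write `g = ∑_{n < q} c_n (1 + X) ^ n`. The functional equation modulo `(x ^ q, y
^ q)` reads `∑ c_n c_m (1 + x) ^ n (1 + y) ^ m = ∑ c_n (1 + x) ^ n (1 + y) ^ n`, so the `c_n` are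
orthogonal idempotents of the field with sum `1`. Exactly one of them is `1`, and the truncation is
that of `(1 + X) ^ n`. -/
theorem exists_nat_choose_eq_coeff {g : PowerSeries F} (hg0 : PowerSeries.constantCoeff g = 1)
    (hg : ∀ s t : MvPowerSeries (Unit ⊕ Unit) F, constantCoeff s = 0 → constantCoeff t = 0 →
      PowerSeries.subst s g * PowerSeries.subst t g = PowerSeries.subst (s + t + s * t) g)
    (k : ℕ) : ∃ n : ℕ, ∀ i < p ^ k, PowerSeries.coeff i g = (n.choose i : F) := by
  classical
  set q := p ^ k with hq
  have hpk : 0 < q := pow_pos (Fact.out : p.Prime).pos k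
  set P : Polynomial F := PowerSeries.trunc q g with hP
  -- The coefficients of `Q` are those of `P` in powers of `1 + X`.
  set Q : Polynomial F := Polynomial.taylor (-1) P with hQ
  have hdeg : Q.natDegree < q := by
    rw [hQ, Polynomial.natDegree_taylor]
    obtain ⟨r, hr⟩ := Nat.exists_eq_succ_of_ne_zero hpk.ne'
    rw [hP, hr]
    exact PowerSeries.natDegree_trunc_lt g r
  have hPQ : P = ∑ n ∈ Finset.range q, Polynomial.C (Q.coeff n) * (Polynomial.X + 1) ^ n := by
    have h1 : P = Polynomial.taylor 1 Q := by
      rw [hQ, Polynomial.taylor_taylor]; simp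
    rw [h1]
    conv_lhs => rw [Polynomial.as_sum_range_C_mul_X_pow' Q hdeg, map_sum]
    simp
  have hcoeff : ∀ i < q, PowerSeries.coeff i g =
      ∑ n ∈ Finset.range q, Q.coeff n * (n.choose i : F) := fun i hi => by
    have h1 : P.coeff i = PowerSeries.coeff i g := by
      rw [hP, PowerSeries.coeff_trunc, if_pos hi]
    rw [← h1, hPQ, Polynomial.finsetSum_coeff]
    simp only [Polynomial.coeff_C_mul, Polynomial.coeff_X_add_one_pow]
  let x : MvPowerSeries (Unit ⊕ Unit) F := X (Sum.inl ())
  let y : MvPowerSeries (Unit ⊕ Unit) F := X (Sum.inr ())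
  have hx : constantCoeff x = 0 := constantCoeff_X _
  have hy : constantCoeff y = 0 := constantCoeff_X _
  have hz : constantCoeff (x + y + x * y) = 0 := by simp [hx, hy]
  have : CharP (MvPowerSeries (Unit ⊕ Unit) F) p :=
    charP_of_injective_ringHom (C_injective (σ := Unit ⊕ Unit)) p
  -- Hence the tail of `g` beyond degree `q` contributes only multiples of `x ^ q` and `y ^ q`,
  -- invisible at `x ^ i y ^ j` with `i, j < q`.
  have hzq : (x + y + x * y) ^ q = x ^ q + y ^ q + x ^ q * y ^ q := by
    rw [hq, add_pow_char_pow, add_pow_char_pow, mul_pow]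
  have hrel : ∀ i < q, ∀ j < q, PowerSeries.coeff i g * PowerSeries.coeff j g =
      ∑ n ∈ Finset.range q, Q.coeff n * (n.choose i : F) * (n.choose j : F) := by
    intro i hi j hj
    set e := Finsupp.sumElim (Finsupp.single () i) (Finsupp.single () j) with he
    have hpow : ∀ n m : ℕ, coeff e ((1 + x) ^ n * (1 + y) ^ m) =
        (n.choose i : F) * (m.choose j : F) := fun n m => by
      have h1 : (1 + x) ^ n = rename (Sum.inl : Unit → Unit ⊕ Unit)
          ((PowerSeries.X + 1 : PowerSeries F) ^ n) := by
        rw [map_pow, map_add, map_one, add_comm]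
        congr 2
        exact (rename_X (Sum.inl : Unit → Unit ⊕ Unit) ()).symm
      have h2 : (1 + y) ^ m = rename (Sum.inr : Unit → Unit ⊕ Unit)
          ((PowerSeries.X + 1 : PowerSeries F) ^ m) := by
        rw [map_pow, map_add, map_one, add_comm]
        congr 2
        exact (rename_X (Sum.inr : Unit → Unit ⊕ Unit) ()).symm
      have h3 : ∀ n i : ℕ, coeff (Finsupp.single () i) ((PowerSeries.X + 1 : PowerSeries F) ^ n) =
          (n.choose i : F) := fun n i => by
        have : (PowerSeries.X + 1 : PowerSeries F) ^ n =
            (((Polynomial.X + 1) ^ n : Polynomial F) : PowerSeries F) := by simp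
        rw [this]
        exact (Polynomial.coeff_coe _ _).trans (Polynomial.coeff_X_add_one_pow _ _ _)
      rw [h1, h2, coeff_rename_inl_mul_rename_inr, h3, h3]
    have hl : PowerSeries.subst x g = rename (Sum.inl : Unit → Unit ⊕ Unit) g := by
      rw [rename_eq_subst]; rfl
    have hr : PowerSeries.subst y g = rename (Sum.inr : Unit → Unit ⊕ Unit) g := by
      rw [rename_eq_subst]; rfl
    have h1 := congrArg (coeff e) (hg x y hx hy)
    rw [hl, hr, coeff_rename_inl_mul_rename_inr] at h1
    refine h1.trans ?_
    have hs := PowerSeries.HasSubst.of_constantCoeff_zero hz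
    have hdvdx : ∀ h : MvPowerSeries (Unit ⊕ Unit) F, coeff e (x ^ q * h) = 0 := fun h =>
      X_pow_dvd_iff.1 (Dvd.intro h rfl) e (by simp [he, hi])
    have hdvdy : ∀ h : MvPowerSeries (Unit ⊕ Unit) F, coeff e (y ^ q * h) = 0 := fun h =>
      X_pow_dvd_iff.1 (Dvd.intro h rfl) e (by simp [he, hj])
    rw [PowerSeries.eq_X_pow_mul_shift_add_trunc q g, PowerSeries.subst_add hs,
      PowerSeries.subst_mul hs, PowerSeries.subst_pow hs, PowerSeries.subst_X hs, hzq, map_add,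
      add_mul, add_mul, map_add, map_add, hdvdx, hdvdy, mul_assoc, hdvdx, zero_add, zero_add,
      zero_add, PowerSeries.subst_coe hs, ← hP, hPQ, map_sum, map_sum]
    refine Finset.sum_congr rfl fun n _ => ?_
    rw [map_mul, Polynomial.aeval_C, map_pow, map_add, Polynomial.aeval_X, map_one,
      show x + y + x * y + 1 = (1 + x) * (1 + y) by ring, mul_pow, ← Algebra.smul_def, coeff_smul,
      hpow, mul_assoc]
  -- Independence of the powers of `1 + X`, applied in one variable and then in the other.
  have hzero : ∀ n < q, ∀ m < q, (if n = m then Q.coeff n else 0) - Q.coeff n * Q.coeff m = 0 := by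
    intro n hn
    refine eq_zero_of_sum_mul_choose_eq_zero fun j hj => ?_
    refine eq_zero_of_sum_mul_choose_eq_zero
      (c := fun n => ∑ m ∈ Finset.range q, ((if n = m then Q.coeff n else 0) -
        Q.coeff n * Q.coeff m) * (m.choose j : F)) (fun i hi => ?_) n hn
    have h1 := hrel i hi j hj
    rw [hcoeff i hi, hcoeff j hj, Finset.sum_mul_sum] at h1
    refine Eq.trans ?_ (sub_eq_zero.2 h1.symm)
    rw [← Finset.sum_sub_distrib]
    refine Finset.sum_congr rfl fun n hn => ?_
    simp only [sub_mul, Finset.sum_sub_distrib, ite_mul, zero_mul, Finset.sum_ite_eq, hn, if_true]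
    congr 1
    · ring
    · rw [Finset.sum_mul]
      exact Finset.sum_congr rfl fun m _ => by ring
  have hsum : ∑ n ∈ Finset.range q, Q.coeff n = 1 := by
    have := hcoeff 0 hpk
    rw [PowerSeries.coeff_zero_eq_constantCoeff_apply, hg0] at this
    simpa using this.symm
  obtain ⟨n, hn, hne⟩ := Finset.exists_ne_zero_of_sum_ne_zero (hsum.trans_ne one_ne_zero)
  rw [Finset.mem_range] at hn
  have hone : Q.coeff n = 1 := by
    have := hzero n hn n hn
    rw [if_pos rfl, sub_eq_zero] at this
    exact (mul_left_cancel₀ hne (by rw [mul_one]; exact this)).symm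
  refine ⟨n, fun i hi => ?_⟩
  rw [hcoeff i hi, Finset.sum_eq_single n]
  · rw [hone, one_mul]
  · intro m hm hmn
    have := hzero n hn m (Finset.mem_range.1 hm)
    rw [if_neg hmn.symm, hone, one_mul, zero_sub, neg_eq_zero] at this
    rw [this, zero_mul]
  · exact fun h => absurd (Finset.mem_range.2 hn) h

/-- The homomorphisms from the formal multiplicative group to itself over a field of characteristic
`p` are the powers with `p`-adic exponents. -/
theorem exists_eq_oneAddPow_X {g : PowerSeries F} (hg0 : PowerSeries.constantCoeff g = 1)
    (hg : ∀ s t : MvPowerSeries (Unit ⊕ Unit) F, constantCoeff s = 0 → constantCoeff t = 0 →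
      PowerSeries.subst s g * PowerSeries.subst t g = PowerSeries.subst (s + t + s * t) g) :
    ∃ t : ℤ_[p], g = oneAddPow (PowerSeries.X : PowerSeries F) t := by
  -- The exponents that are correct modulo `X ^ (p ^ k)` form a decreasing sequence of nonempty
  -- closed sets. By compactness of `ℤ_p` one exponent works in all degrees.
  let K : ℕ → Set ℤ_[p] := fun k =>
    ⋂ i ∈ Set.Iio (p ^ k), {t | binom F t i ∈ ({PowerSeries.coeff i g} : Set F)}
  have hclosed : ∀ k, IsClosed (K k) := fun k => isClosed_biInter fun i _ => by
    rw [← isOpen_compl_iff]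
    exact isOpen_binom_preimage i {PowerSeries.coeff i g}ᶜ
  obtain ⟨t, ht⟩ := IsCompact.nonempty_iInter_of_sequence_nonempty_isCompact_isClosed K
    (fun k => Set.biInter_mono (Set.Iio_subset_Iio
      (Nat.pow_le_pow_right (Fact.out : p.Prime).pos (Nat.le_succ k))) fun _ _ => subset_rfl)
    (fun k => by
      obtain ⟨n, hn⟩ := exists_nat_choose_eq_coeff (p := p) hg0 hg k
      refine ⟨n, Set.mem_iInter₂.2 fun i hi => ?_⟩
      rw [Set.mem_ofPred_eq, binom_natCast, hn i hi]
      rfl)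
    (hclosed 0).isCompact hclosed
  refine ⟨t, PowerSeries.ext fun i => ?_⟩
  rw [coeff_oneAddPow_X]
  have h := Set.mem_iInter₂.1 (Set.mem_iInter.1 ht i) i
    (Nat.lt_pow_self (Fact.out : p.Prime).one_lt)
  exact (Set.mem_singleton_iff.1 h).symm

end Characters

end

end WeightedIVP

namespace WeightedIVP

noncomputable section

open scoped Classical

/-! ### Block idempotents and central characters. -/

section BlockIdempotents

variable {F : Type*} [Field F] {Γ : Type*} [Group Γ]

/-- The central idempotent that generates a block. -/
def blockIdem (u : Block F Γ) : GroupCenter F Γ :=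
  ⟨u.2.exists_isUnit.choose, Subalgebra.mem_center_iff.2 fun x => by
    obtain ⟨he, -, hu⟩ := u.2.exists_isUnit.choose_spec
    rw [← (hu _ (u.1.mul_mem_left x _ he)).1, ← mul_assoc, (hu _ (u.1.mul_mem_right _ x he)).2]⟩

theorem blockIdem_mem (u : Block F Γ) : (blockIdem u : MonoidAlgebra F Γ) ∈ u.1 :=
  u.2.exists_isUnit.choose_spec.1

theorem blockIdem_mul {u : Block F Γ} {x : MonoidAlgebra F Γ} (hx : x ∈ u.1) :
    (blockIdem u : MonoidAlgebra F Γ) * x = x :=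
  (u.2.exists_isUnit.choose_spec.2.2 x hx).1

theorem blockIdem_mul_self (u : Block F Γ) : blockIdem u * blockIdem u = blockIdem u :=
  Subtype.ext (blockIdem_mul (blockIdem_mem u))

theorem blockIdem_mul_of_ne {u v : Block F Γ} (h : u ≠ v) : blockIdem u * blockIdem v = 0 :=
  Subtype.ext (IsBlock.mul_eq_zero v.2 u.2 (fun h' => h (Subtype.ext h'.symm)) _ (blockIdem_mem v)
    _ (blockIdem_mem u))

/-- The two-sided ideal generated by a primitive central idempotent is a block. -/
theorem exists_blockIdem_eq {g : GroupCenter F Γ} (hg : g * g = g) (hg0 : g ≠ 0)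
    (hprim : ∀ h : GroupCenter F Γ, h * h = h → h ≠ 0 → g * h = h → h = g) :
    ∃ u : Block F Γ, blockIdem u = g := by
  have hz : ∀ x : MonoidAlgebra F Γ, x * (g : MonoidAlgebra F Γ) = g * x :=
    Subalgebra.mem_center_iff.1 g.2
  have hgg : (g : MonoidAlgebra F Γ) * g = g := congrArg Subtype.val hg
  let C : TwoSidedIdeal (MonoidAlgebra F Γ) := TwoSidedIdeal.mk' {x | (g : MonoidAlgebra F Γ) * x = x}
    (mul_zero _) (fun {x y} hx hy => by
      change _ * (x + y) = _
      rw [mul_add, Set.mem_ofPred_eq.mp hx, Set.mem_ofPred_eq.mp hy])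
    (fun {x} hx => by
      change _ * (-x) = _
      rw [mul_neg, Set.mem_ofPred_eq.mp hx])
    (fun {x y} hx => by
      change _ * (x * y) = _
      rw [← mul_assoc, ← hz, mul_assoc, Set.mem_ofPred_eq.mp hx])
    (fun {x y} hx => by
      change _ * (x * y) = _
      rw [← mul_assoc, Set.mem_ofPred_eq.mp hx])
  let D : TwoSidedIdeal (MonoidAlgebra F Γ) := TwoSidedIdeal.mk' {x | (g : MonoidAlgebra F Γ) * x = 0}
    (mul_zero _) (fun {x y} hx hy => by
      change _ * (x + y) = _
      rw [mul_add, Set.mem_ofPred_eq.mp hx, Set.mem_ofPred_eq.mp hy, add_zero])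
    (fun {x} hx => by
      change _ * (-x) = _
      rw [mul_neg, Set.mem_ofPred_eq.mp hx, neg_zero])
    (fun {x y} hx => by
      change _ * (x * y) = _
      rw [← mul_assoc, ← hz, mul_assoc, Set.mem_ofPred_eq.mp hx, mul_zero])
    (fun {x y} hx => by
      change _ * (x * y) = _
      rw [← mul_assoc, Set.mem_ofPred_eq.mp hx, zero_mul])
  have hC : ∀ x, x ∈ C ↔ (g : MonoidAlgebra F Γ) * x = x :=
    fun x => TwoSidedIdeal.mem_mk' _ _ _ _ _ _ x
  have hD : ∀ x, x ∈ D ↔ (g : MonoidAlgebra F Γ) * x = 0 :=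
    fun x => TwoSidedIdeal.mem_mk' _ _ _ _ _ _ x
  have hgC : (g : MonoidAlgebra F Γ) ∈ C := (hC _).2 hgg
  have hblock : IsBlock C := by
    refine ⟨fun h => ?_, ⟨D, ?_⟩, fun I J hsup hinf => ?_⟩
    · rw [h, TwoSidedIdeal.mem_bot] at hgC
      exact hg0 (Subtype.ext hgC)
    · refine IsCompl.of_eq ?_ ?_
      · refine le_antisymm (fun x hx => ?_) bot_le
        obtain ⟨h1, h2⟩ := (TwoSidedIdeal.mem_inf _).1 hx
        exact (TwoSidedIdeal.mem_bot _).2 (((hC x).1 h1).symm.trans ((hD x).1 h2))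
      · refine le_antisymm le_top fun x _ => TwoSidedIdeal.mem_sup.2
          ⟨g * x, (hC _).2 (by rw [← mul_assoc, hgg]), x - g * x, (hD _).2 ?_, by abel⟩
        rw [mul_sub, ← mul_assoc, hgg, sub_self]
    · have hmem : (g : MonoidAlgebra F Γ) ∈ I ⊔ J := by rw [hsup]; exact hgC
      obtain ⟨i, hi, j, hj, hij⟩ := TwoSidedIdeal.mem_sup.1 hmem
      have h0 : ∀ x ∈ I, ∀ y ∈ J, x * y = 0 ∧ y * x = 0 := fun x hx y hy => by
        have h : ∀ z, z ∈ I → z ∈ J → z = 0 := fun z h1 h2 => by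
          have h3 : z ∈ I ⊓ J := (TwoSidedIdeal.mem_inf _).2 ⟨h1, h2⟩
          rwa [hinf, TwoSidedIdeal.mem_bot] at h3
        exact ⟨h _ (I.mul_mem_right _ _ hx) (J.mul_mem_left _ _ hy),
          h _ (I.mul_mem_left _ _ hx) (J.mul_mem_right _ _ hy)⟩
      have hIC : I ≤ C := by rw [← hsup]; exact le_sup_left
      have hJC : J ≤ C := by rw [← hsup]; exact le_sup_right
      -- If `C = I ⊕ J`, the component `i` of `g` in `I` is the identity of `I`, hence a central
      -- idempotent below `g`. Primitivity forces `i = 0` or `i = g`, that is `I = 0` or `J = 0`.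
      have hIi : ∀ x ∈ I, i * x = x ∧ x * i = x := fun x hx => by
        have h1 := (hC x).1 (hIC hx)
        have h2 := h1
        rw [← hz] at h2
        rw [← hij, add_mul, (h0 x hx j hj).2, add_zero] at h1
        rw [← hij, mul_add, (h0 x hx j hj).1, add_zero] at h2
        exact ⟨h1, h2⟩
      have hicentral : i ∈ Subalgebra.center F (MonoidAlgebra F Γ) :=
        Subalgebra.mem_center_iff.2 fun x => by
          rw [← (hIi _ (I.mul_mem_left x i hi)).1, ← mul_assoc,
            (hIi _ (I.mul_mem_right i x hi)).2]
      by_cases hi0 : i = 0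
      · left
        refine le_antisymm (fun x hx => (TwoSidedIdeal.mem_bot _).2 ?_) bot_le
        rw [← (hIi x hx).1, hi0, zero_mul]
      · right
        have hig : (⟨i, hicentral⟩ : GroupCenter F Γ) = g :=
          hprim _ (Subtype.ext (hIi i hi).1) (fun h => hi0 (congrArg Subtype.val h))
            (Subtype.ext ((hC i).1 (hIC hi)))
        have hig' : i = g := congrArg Subtype.val hig
        refine le_antisymm (fun y hy => (TwoSidedIdeal.mem_bot _).2 ?_) bot_le
        rw [← (hC y).1 (hJC hy), ← hig', (h0 i hi y hy).1]
  refine ⟨⟨C, hblock⟩, Subtype.ext ?_⟩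
  have h1 : (blockIdem ⟨C, hblock⟩ : MonoidAlgebra F Γ) * g = g := blockIdem_mul hgC
  have h2 := (hC _).1 (blockIdem_mem ⟨C, hblock⟩)
  rw [← hz, h1] at h2
  exact h2.symm

variable [Fintype Γ]

/-- Otherwise `1 - e` is a nonzero idempotent orthogonal to all blocks. Since the centre is
Artinian, among the ideals generated by such idempotents there is a minimal one; its generator is
primitive and so generates a block, a contradiction. -/
theorem sum_blockIdem : ∑ u : Block F Γ, blockIdem u = 1 := by
  have : IsArtinianRing (GroupCenter F Γ) := IsArtinianRing.of_finite F _
  set e : GroupCenter F Γ := ∑ u : Block F Γ, blockIdem u with he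
  have heu : ∀ u : Block F Γ, e * blockIdem u = blockIdem u := fun u => by
    rw [he, Finset.sum_mul, Finset.sum_eq_single u, blockIdem_mul_self]
    · exact fun v _ hv => blockIdem_mul_of_ne hv
    · simp
  have hee : e * e = e := by
    conv_lhs => rw [he, Finset.sum_mul]
    rw [he]
    refine Finset.sum_congr rfl fun u _ => ?_
    rw [← he, mul_comm, heu]
  by_contra hne
  let S : Set (Ideal (GroupCenter F Γ)) :=
    {I | ∃ g : GroupCenter F Γ, g * g = g ∧ g ≠ 0 ∧ e * g = 0 ∧ I = Ideal.span {g}}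
  have hid : IsIdempotentElem e := hee
  have hS : S.Nonempty := ⟨_, _, hid.one_sub, sub_ne_zero.2 (Ne.symm hne), hid.mul_one_sub_self, rfl⟩
  obtain ⟨I, ⟨g, hg, hg0, heg, rfl⟩, hmin⟩ := IsArtinian.set_has_minimal S hS
  obtain ⟨u, hu⟩ := exists_blockIdem_eq hg hg0 fun h hh hh0 hgh => by
    have hle : Ideal.span {h} ≤ Ideal.span {g} := by
      rw [Ideal.span_singleton_le_span_singleton]
      exact ⟨h, hgh.symm⟩
    have heq : Ideal.span {h} = Ideal.span {g} := by
      by_contra hlt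
      exact hmin _ ⟨h, hh, hh0, by rw [← hgh, ← mul_assoc, heg, zero_mul], rfl⟩
        (lt_of_le_of_ne hle hlt)
    -- Two idempotents of a commutative ring that generate the same ideal are equal.
    obtain ⟨r, hr⟩ := Ideal.span_singleton_le_span_singleton.1 heq.ge
    calc h = g * h := hgh.symm
      _ = h * h * r := by rw [hr]; ring
      _ = g := by rw [hh, ← hr]
  apply hg0
  rw [← heg, ← hu, heu]

variable [IsAlgClosed F]

theorem centralCharacter_smul (M : Type*) [AddCommGroup M] [Module (MonoidAlgebra F Γ) M]
    [IsSimpleModule (MonoidAlgebra F Γ) M] (z : GroupCenter F Γ) (m : M) :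
    (z : MonoidAlgebra F Γ) • m =
      algebraMap F (MonoidAlgebra F Γ) (centralCharacter M z) • m :=
  (exists_scalar M z).choose_spec m

theorem centralCharacter_eq_of_smul (M : Type*) [AddCommGroup M] [Module (MonoidAlgebra F Γ) M]
    [IsSimpleModule (MonoidAlgebra F Γ) M] {z : GroupCenter F Γ} {a : F} {m : M} (hm : m ≠ 0)
    (h : (z : MonoidAlgebra F Γ) • m = algebraMap F (MonoidAlgebra F Γ) a • m) :
    centralCharacter M z = a := by
  by_contra hne
  apply hm
  have h1 : algebraMap F (MonoidAlgebra F Γ) (centralCharacter M z - a) • m = 0 := by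
    rw [map_sub, sub_smul, ← centralCharacter_smul, h, sub_self]
  have h2 := congrArg
    (fun x => algebraMap F (MonoidAlgebra F Γ) (centralCharacter M z - a)⁻¹ • x) h1
  simpa only [smul_zero, ← mul_smul, ← map_mul, inv_mul_cancel₀ (sub_ne_zero.2 hne), map_one,
    one_smul] using h2

section CentralCharacter

variable (M : Type*) [AddCommGroup M] [Module (MonoidAlgebra F Γ) M]
  [IsSimpleModule (MonoidAlgebra F Γ) M]

theorem centralCharacter_eq_of_forall {z : GroupCenter F Γ} {a : F}
    (h : ∀ m : M, (z : MonoidAlgebra F Γ) • m = algebraMap F (MonoidAlgebra F Γ) a • m) :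
    centralCharacter M z = a := by
  have : Nontrivial M := IsSimpleModule.nontrivial (MonoidAlgebra F Γ) M
  obtain ⟨m, hm⟩ := exists_ne (0 : M)
  exact centralCharacter_eq_of_smul M hm (h m)

theorem centralCharacter_algebraMap (r : F) :
    centralCharacter M (algebraMap F (GroupCenter F Γ) r) = r :=
  centralCharacter_eq_of_forall M fun m => by rw [Subalgebra.coe_algebraMap]

theorem centralCharacter_add (x y : GroupCenter F Γ) :
    centralCharacter M (x + y) = centralCharacter M x + centralCharacter M y :=
  centralCharacter_eq_of_forall M fun m => by
    rw [Subalgebra.coe_add, add_smul, centralCharacter_smul, centralCharacter_smul, map_add,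
      add_smul]

theorem centralCharacter_mul (x y : GroupCenter F Γ) :
    centralCharacter M (x * y) = centralCharacter M x * centralCharacter M y :=
  centralCharacter_eq_of_forall M fun m => by
    rw [Subalgebra.coe_mul, mul_smul, centralCharacter_smul, centralCharacter_smul, map_mul,
      mul_smul]

end CentralCharacter

/-- The central character of a block, as an algebra homomorphism. -/
def blockHom (u : Block F Γ) : GroupCenter F Γ →ₐ[F] F where
  toFun := centralCharacter u.Simple
  map_one' := by rw [← map_one (algebraMap F (GroupCenter F Γ)), centralCharacter_algebraMap]
  map_mul' := centralCharacter_mul _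
  map_zero' := by rw [← map_zero (algebraMap F (GroupCenter F Γ)), centralCharacter_algebraMap]
  map_add' := centralCharacter_add _
  commutes' r := centralCharacter_algebraMap _ r

theorem blockHom_classSum (u : Block F Γ) (c : ConjClasses Γ) :
    blockHom u (classSum F c) = blockCharacter u c := rfl

theorem blockHom_blockIdem_self (u : Block F Γ) : blockHom u (blockIdem u) = 1 := by
  obtain ⟨b, hb, m, hm⟩ := u.exists_simple.choose_spec.2
  refine centralCharacter_eq_of_smul u.Simple hm ?_
  rw [← mul_smul, blockIdem_mul hb, map_one, one_smul]

theorem blockHom_blockIdem_of_ne {u v : Block F Γ} (h : u ≠ v) : blockHom u (blockIdem v) = 0 := by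
  have h1 := congrArg (blockHom u) (blockIdem_mul_of_ne h)
  rwa [map_mul, blockHom_blockIdem_self, one_mul, map_zero] at h1

/-- A Fitting argument for `w = z - ω^u(z)`. The Artinian condition gives an idempotent `f`, a
multiple of `w`, with `w ^ (n + 1) f = w ^ (n + 1)`. On an indecomposable block `f` acts as `0` or
`1`, and `ω^u(f) = 0` excludes `1`; so `w` is nilpotent on the block. -/
theorem exists_blockIdem_mul_pow_eq_zero (u : Block F Γ) (z : GroupCenter F Γ) :
    ∃ n : ℕ, blockIdem u * (z - algebraMap F _ (blockHom u z)) ^ n = 0 := by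
  have : IsArtinianRing (GroupCenter F Γ) := IsArtinianRing.of_finite F _
  let w : GroupCenter F Γ := z - algebraMap F _ (blockHom u z)
  have hw : blockHom u w = 0 := by
    simp [w]
  obtain ⟨n, y, hy⟩ := IsArtinian.exists_pow_succ_smul_dvd w (1 : GroupCenter F Γ)
  simp only [smul_eq_mul, mul_one] at hy
  have hy1 : w ^ (n + 1) * (w * y) = w ^ (n + 1) := by
    calc w ^ (n + 1) * (w * y) = w * (w ^ (n + 1) * y) := by ring
      _ = w ^ (n + 1) := by rw [hy]; ring
  have hy2 : ∀ k : ℕ, w ^ (n + 1) * (w * y) ^ k = w ^ (n + 1) := fun k => by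
    induction k with
    | zero => simp
    | succ k ih => rw [pow_succ (w * y) k, ← mul_assoc, ih, hy1]
  let f : GroupCenter F Γ := (w * y) ^ (n + 1)
  have hff : f * f = f := by
    calc f * f = w ^ (n + 1) * (w * y) ^ (n + 1) * y ^ (n + 1) := by simp only [f]; ring
      _ = f := by rw [hy2]; simp only [f]; ring
  have hf0 : blockHom u f = 0 := by simp [f, hw]
  refine ⟨n + 1, ?_⟩
  rcases u.2.split (f := (f : MonoidAlgebra F Γ)) (congrArg Subtype.val hff)
    (Subalgebra.mem_center_iff.1 f.2) with h | h
  · have h1 : f * blockIdem u = 0 := Subtype.ext (h _ (blockIdem_mem u))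
    change blockIdem u * w ^ (n + 1) = 0
    rw [← hy2 (n + 1), mul_left_comm, mul_comm (blockIdem u)]
    change _ * (f * blockIdem u) = 0
    rw [h1, mul_zero]
  · have h1 : f * blockIdem u = blockIdem u := Subtype.ext (h _ (blockIdem_mem u))
    have h2 := congrArg (blockHom u) h1
    rw [map_mul, hf0, zero_mul, blockHom_blockIdem_self] at h2
    exact absurd h2 zero_ne_one

end BlockIdempotents

end

end WeightedIVP

namespace WeightedIVP

open MvPowerSeries

noncomputable section

open scoped Classical

/-! ### Multiplicative series as characters of groups of units over the centre. -/

section Identities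

variable {R : Type*} [CommRing R]

theorem mul_sub_one_eq (a b : R) : a * b - 1 = a - 1 + (b - 1) + (a - 1) * (b - 1) := by ring

theorem one_add_mul_one_add_of_idem {e : R} (he : e * e = e) (s t : R) :
    (1 + e * s) * (1 + e * t) = 1 + e * (s + t + s * t) := by
  linear_combination s * t * he

end Identities

section Coordinates

variable {F : Type*} [Field F] {Γ : Type*} [Group Γ] {τ : Type*}

/-- The coordinates with respect to the class sums of a power series with central coefficients. -/
def classCoords (z : MvPowerSeries τ (GroupCenter F Γ)) (c : ConjClasses Γ) : MvPowerSeries τ F :=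
  fun N => classCoeff c (coeff N z)

theorem coeff_classCoords (z : MvPowerSeries τ (GroupCenter F Γ)) (c : ConjClasses Γ)
    (N : τ →₀ ℕ) : coeff N (classCoords z c) = classCoeff c (coeff N z) := rfl

theorem constantCoeff_classCoords {z : MvPowerSeries τ (GroupCenter F Γ)}
    (hz : constantCoeff z = 0) (c : ConjClasses Γ) : constantCoeff (classCoords z c) = 0 := by
  rw [← coeff_zero_eq_constantCoeff_apply, coeff_classCoords, coeff_zero_eq_constantCoeff_apply,
    hz, map_zero]

theorem classCoords_C_mul_map (e : GroupCenter F Γ) (s : MvPowerSeries τ F) (c : ConjClasses Γ) :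
    classCoords (C e * map (algebraMap F _) s) c = C (classCoeff c e) * s := by
  ext N
  rw [coeff_classCoords, coeff_C_mul, coeff_C_mul, coeff_map, mul_comm, ← Algebra.smul_def,
    map_smul, smul_eq_mul, mul_comm]

variable [Fintype Γ]

theorem sum_C_classSum_mul_classCoords (z : MvPowerSeries τ (GroupCenter F Γ)) :
    ∑ c, C (classSum F c) * map (algebraMap F _) (classCoords z c) = z := by
  ext1 N
  rw [map_sum]
  conv_rhs => rw [← sum_classCoeff_smul (coeff N z)]
  refine Finset.sum_congr rfl fun c _ => ?_
  rw [coeff_C_mul, coeff_map, coeff_classCoords, Algebra.smul_def, mul_comm]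

theorem classCoords_sum (s : ConjClasses Γ → MvPowerSeries τ F) :
    classCoords (∑ c, C (classSum F c) * map (algebraMap F _) (s c)) = s := by
  funext d
  ext N
  have h : ∀ c, classCoeff d (coeff N (C (classSum F c) * map (algebraMap F _) (s c))) =
      if d = c then coeff N (s c) else 0 := fun c => by
    rw [← coeff_classCoords, classCoords_C_mul_map, classCoeff_classSum, coeff_C_mul, ite_mul,
      one_mul, zero_mul]
  rw [coeff_classCoords, map_sum, map_sum, Finset.sum_congr rfl fun c _ => h c]
  simp

theorem classCoords_conv (z w : MvPowerSeries τ (GroupCenter F Γ)) :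
    classCoords (z + w + z * w) = conv classConst (classCoords z) (classCoords w) := by
  rw [← classCoords_sum (conv classConst (classCoords z) (classCoords w))]
  congr 1
  have h := sum_mul_conv (a := classConst) (κ := fun c => C (σ := τ) (classSum F (Γ := Γ) c))
    (fun c d => by
      rw [← map_mul, classSum_mul, map_sum]
      exact Finset.sum_congr rfl fun e _ =>
        (map_mul _ _ _).trans (congrArg (· * _) (map_intCast _ _)))
    (fun c => map (algebraMap F _) (classCoords z c)) fun c => map (algebraMap F _) (classCoords w c)
  simp only [sum_C_classSum_mul_classCoords] at h
  rw [← h]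
  refine Finset.sum_congr rfl fun c _ => ?_
  rw [map_conv]

/-- The value of `G` at an element `a` with constant coefficient `1`. -/
def evalUnit (G : MvPowerSeries (ConjClasses Γ) F) (a : MvPowerSeries τ (GroupCenter F Γ)) :
    MvPowerSeries τ F := subst (classCoords (a - 1)) G

variable {G : MvPowerSeries (ConjClasses Γ) F}

/-- In class sum coordinates around `1`, multiplication of units is the group law `conv`; this lets
identities among units of the centre be transported through `G`. -/
theorem evalUnit_mul (hG : IsMult classConst G) {a b : MvPowerSeries τ (GroupCenter F Γ)}
    (ha : constantCoeff a = 1) (hb : constantCoeff b = 1) :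
    evalUnit G (a * b) = evalUnit G a * evalUnit G b := by
  rw [evalUnit, evalUnit, evalUnit,
    hG.subst_mul_subst (constantCoeff_classCoords (by rw [map_sub, ha, map_one, sub_self]))
      (constantCoeff_classCoords (by rw [map_sub, hb, map_one, sub_self])), ← classCoords_conv]
  congr 2
  exact mul_sub_one_eq a b

theorem evalUnit_one (hG : IsMult classConst G) :
    evalUnit G (1 : MvPowerSeries τ (GroupCenter F Γ)) = 1 := by
  have h : classCoords (1 - 1 : MvPowerSeries τ (GroupCenter F Γ)) = 0 := by
    funext c
    ext N
    rw [coeff_classCoords, sub_self, map_zero, map_zero]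
    rfl
  rw [evalUnit, h, subst_zero_eq_C_constantCoeff, hG.constantCoeff_eq]
  simp

theorem evalUnit_prod (hG : IsMult classConst G) {ι : Type*} (S : Finset ι)
    {a : ι → MvPowerSeries τ (GroupCenter F Γ)} (ha : ∀ i, constantCoeff (a i) = 1) :
    evalUnit G (∏ i ∈ S, a i) = ∏ i ∈ S, evalUnit G (a i) := by
  induction S using Finset.induction_on with
  | empty => simpa using evalUnit_one hG
  | insert i S hi ih =>
    rw [Finset.prod_insert hi, Finset.prod_insert hi, evalUnit_mul hG (ha i) (by simp [ha]), ih]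

theorem evalUnit_pow (hG : IsMult classConst G) {a : MvPowerSeries τ (GroupCenter F Γ)}
    (ha : constantCoeff a = 1) (n : ℕ) : evalUnit G (a ^ n) = evalUnit G a ^ n := by
  simpa using evalUnit_prod hG (Finset.range n) (a := fun _ => a) fun _ => ha

/-- The generic unit has the variables as coordinates, so `G` itself is recovered as one of its
values. -/
theorem evalUnit_generic (G : MvPowerSeries (ConjClasses Γ) F) :
    evalUnit G (1 + ∑ c, C (classSum F c) * X c) = G := by
  have h := classCoords_sum (F := F) (Γ := Γ) X
  simp only [map_X] at h
  rw [evalUnit, add_sub_cancel_left, h, subst_self, id]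

/-- The restriction of `G` to the line spanned by a central element. -/
def restrictLine (G : MvPowerSeries (ConjClasses Γ) F) (e : GroupCenter F Γ) : PowerSeries F :=
  subst (fun c => (C (classCoeff c e) * X () : MvPowerSeries Unit F)) G

theorem evalUnit_line (G : MvPowerSeries (ConjClasses Γ) F) (e : GroupCenter F Γ)
    {s : MvPowerSeries τ F} (hs : constantCoeff s = 0) :
    evalUnit G (1 + C e * map (algebraMap F _) s) = PowerSeries.subst s (restrictLine G e) := by
  have hs' : HasSubst (fun _ : Unit => s) := hasSubst_of_constantCoeff_zero fun _ => hs
  rw [evalUnit, add_sub_cancel_left, PowerSeries.subst_def, restrictLine,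
    subst_comp_subst_apply (hasSubst_of_constantCoeff_zero (by simp)) hs']
  congr 1
  funext c
  rw [classCoords_C_mul_map, subst_mul hs', subst_X hs', subst_C]

theorem constantCoeff_restrictLine (hG : IsMult classConst G) (e : GroupCenter F Γ) :
    PowerSeries.constantCoeff (restrictLine G e) = 1 := by
  have h := constantCoeff_subst_zero (τ := Unit) (S := F)
    (a := fun c => (C (classCoeff c e) * X () : MvPowerSeries Unit F)) (by simp) G
  rw [hG.constantCoeff_eq, map_one] at h
  exact h

/-- For an idempotent `e`, `s ↦ 1 + e s` embeds the multiplicative group: `(1 + e s)(1 + e t) = 1 +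
e (s + t + s t)`. So the restriction of `G` is an endomorphism of the formal multiplicative group.
-/
theorem subst_restrictLine_mul (hG : IsMult classConst G) {e : GroupCenter F Γ} (he : e * e = e)
    {s t : MvPowerSeries τ F} (hs : constantCoeff s = 0) (ht : constantCoeff t = 0) :
    PowerSeries.subst s (restrictLine G e) * PowerSeries.subst t (restrictLine G e) =
      PowerSeries.subst (s + t + s * t) (restrictLine G e) := by
  rw [← evalUnit_line G e hs, ← evalUnit_line G e ht, ← evalUnit_line G e (by simp [hs, ht]),
    ← evalUnit_mul hG (by simp [hs]) (by simp [ht])]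
  congr 1
  have hC : (C e * C e : MvPowerSeries τ (GroupCenter F Γ)) = C e := by rw [← map_mul, he]
  rw [map_add, map_add, map_mul]
  exact one_add_mul_one_add_of_idem hC _ _

end Coordinates

section Orthogonal

theorem prod_one_add_mul_of_orthogonal {R ι : Type*} [CommRing R] {e : ι → R}
    (he : ∀ i j, i ≠ j → e i * e j = 0) (l : ι → R) (S : Finset ι) :
    ∏ i ∈ S, (1 + e i * l i) = 1 + ∑ i ∈ S, e i * l i := by
  induction S using Finset.induction_on with
  | empty => simp
  | insert i S hi ih =>
    have h : e i * l i * ∑ j ∈ S, e j * l j = 0 := by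
      rw [Finset.mul_sum]
      refine Finset.sum_eq_zero fun j hj => ?_
      rw [mul_mul_mul_comm, he i j (fun h => hi (h ▸ hj)), zero_mul]
    rw [Finset.prod_insert hi, Finset.sum_insert hi, ih, add_mul, one_mul, mul_add, h]
    ring

end Orthogonal

/-! ### Product formula over the blocks, and its uniqueness. -/

section BlockFormulas

variable {p : ℕ} [Fact p.Prime] {F : Type*} [Field F] [IsAlgClosed F] [CharP F p]
  {Γ : Type*} [Group Γ] [Fintype Γ]

omit [Fact p.Prime] [CharP F p] in
theorem blockForm_eq (u : Block F Γ) :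
    blockForm u = ∑ c, C (blockCharacter u c) * X c := by
  rw [blockForm]
  refine Finset.sum_congr rfl fun c _ => ?_
  rw [X, ← monomial_zero_eq_C_apply, monomial_mul_monomial, zero_add, mul_one]

omit [Fact p.Prime] [CharP F p] in
theorem constantCoeff_blockForm (u : Block F Γ) : constantCoeff (blockForm u) = 0 := by
  simp [blockForm_eq]

omit [Fact p.Prime] [CharP F p] in
theorem subst_blockForm {τ : Type*} {s : ConjClasses Γ → MvPowerSeries τ F}
    (hs : ∀ c, constantCoeff (s c) = 0) (u : Block F Γ) :
    subst s (blockForm u) = ∑ c, C (blockCharacter u c) * s c := by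
  have h := hasSubst_of_constantCoeff_zero hs
  rw [blockForm_eq, ← coe_substAlgHom h, map_sum]
  refine Finset.sum_congr rfl fun c _ => ?_
  rw [map_mul, coe_substAlgHom, subst_X h, subst_C]

/-- Some `p`-power of the generic element is a product of elements coming from the blocks. -/
theorem exists_generic_pow_eq (F : Type*) [Field F] [IsAlgClosed F] [CharP F p]
    (Γ : Type*) [Group Γ] [Fintype Γ] :
    ∃ k : ℕ, (1 + ∑ c, C (classSum F (Γ := Γ) c) * X c) ^ p ^ k =
      ∏ u : Block F Γ, (1 + C (blockIdem u) * map (algebraMap F _) (blockForm u ^ p ^ k)) := by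
  choose n hn using fun (x : Block F Γ × ConjClasses Γ) =>
    exists_blockIdem_mul_pow_eq_zero x.1 (classSum F x.2)
  -- One exponent kills the nilpotent parts of all class sums on all blocks; the sum of the `n x`
  -- suffices because `k < p ^ k`.
  obtain ⟨k, hk⟩ : ∃ k : ℕ, ∀ x, n x ≤ p ^ k := by
    refine ⟨∑ x, n x, fun x => ?_⟩
    exact (Finset.single_le_sum (fun _ _ => Nat.zero_le _) (Finset.mem_univ x)).trans
      (Nat.lt_pow_self (Fact.out : p.Prime).one_lt).le
  refine ⟨k, ?_⟩
  set q := p ^ k with hq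
  have : CharP (MvPowerSeries (ConjClasses Γ) (GroupCenter F Γ)) p :=
    charP_of_injective_ringHom
      (f := (C (σ := ConjClasses Γ)).comp (algebraMap F (GroupCenter F Γ)))
      (RingHom.injective _) p
  have : ExpChar (MvPowerSeries (ConjClasses Γ) (GroupCenter F Γ)) p :=
    ExpChar.prime Fact.out
  set a : MvPowerSeries (ConjClasses Γ) (GroupCenter F Γ) := 1 + ∑ c, C (classSum F c) * X c with ha
  -- On the component of `u` the generic unit is `1 + ℓ_u` plus a combination of nilpotents, and the
  -- `q`-th power is additive.
  have hu : ∀ u : Block F Γ, C (blockIdem u) * a ^ q =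
      C (blockIdem u) * (1 + map (algebraMap F _) (blockForm u ^ q)) := fun u => by
    have h1 : a = 1 + map (algebraMap F _) (blockForm u) +
        ∑ c, C (classSum F c - algebraMap F _ (blockHom u (classSum F c))) * X c := by
      rw [ha, blockForm_eq, map_sum, add_assoc, ← Finset.sum_add_distrib]
      congr 1
      refine Finset.sum_congr rfl fun c _ => ?_
      rw [map_mul, map_C, map_X, ← add_mul, ← map_add, blockHom_classSum, add_sub_cancel]
    have h2 : C (blockIdem u) * (∑ c, C (classSum F c -
        algebraMap F _ (blockHom u (classSum F c))) * X c) ^ q = 0 := by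
      rw [hq, sum_pow_char_pow, Finset.mul_sum]
      refine Finset.sum_eq_zero fun c _ => ?_
      rw [mul_pow, ← mul_assoc, ← map_pow, ← map_mul, ← hq,
        ← Nat.add_sub_cancel' (hk (u, c)), pow_add, ← mul_assoc, hn (u, c), zero_mul, map_zero,
        zero_mul]
    rw [h1, hq, add_pow_char_pow, add_pow_char_pow, one_pow, ← hq, mul_add, h2, add_zero, map_pow]
  have hsum : (∑ u : Block F Γ, C (σ := ConjClasses Γ) (blockIdem u)) = 1 := by
    rw [← map_sum, sum_blockIdem, map_one]
  rw [prod_one_add_mul_of_orthogonal (fun u v huv => by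
    rw [← map_mul, blockIdem_mul_of_ne huv, map_zero])]
  calc a ^ q = ∑ u : Block F Γ, C (blockIdem u) * a ^ q := by rw [← Finset.sum_mul, hsum, one_mul]
    _ = ∑ u : Block F Γ, (C (blockIdem u) +
          C (blockIdem u) * map (algebraMap F _) (blockForm u ^ q)) :=
        Finset.sum_congr rfl fun u _ => by rw [hu, mul_add, mul_one]
    _ = _ := by rw [Finset.sum_add_distrib, hsum]

omit [IsAlgClosed F] in
theorem powerSeries_subst_oneAddPow_X {τ : Type*} {s : MvPowerSeries τ F}
    (hs : constantCoeff s = 0) (t : ℤ_[p]) :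
    PowerSeries.subst s (oneAddPow (PowerSeries.X : PowerSeries F) t : PowerSeries F) =
      oneAddPow s t := by
  rw [PowerSeries.subst_def, subst_oneAddPow (fun _ => hs) PowerSeries.constantCoeff_X]
  congr 1
  exact PowerSeries.subst_X (PowerSeries.HasSubst.of_constantCoeff_zero hs)

/-- The multiplicative power series are the products of `p`-adic powers of the block forms. -/
theorem IsMult.exists_eq_prod_oneAddPow {G : MvPowerSeries (ConjClasses Γ) F}
    (hG : IsMult classConst G) :
    ∃ t : Block F Γ → ℤ_[p], G = ∏ u, oneAddPow (blockForm u) (t u) := by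
  choose t ht using fun u : Block F Γ => exists_eq_oneAddPow_X (p := p)
    (constantCoeff_restrictLine hG (blockIdem u))
    (fun s t hs ht => subst_restrictLine_mul hG (blockIdem_mul_self u) hs ht)
  refine ⟨t, ?_⟩
  obtain ⟨k, hk⟩ := exists_generic_pow_eq (p := p) F Γ
  have hpk : p ^ k ≠ 0 := pow_ne_zero _ (Fact.out : p.Prime).ne_zero
  have hform : ∀ u : Block F Γ, constantCoeff (blockForm u ^ p ^ k) = 0 := fun u => by
    rw [map_pow, constantCoeff_blockForm, zero_pow hpk]
  have h := congrArg (evalUnit G) hk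
  rw [evalUnit_pow hG (by simp), evalUnit_generic, evalUnit_prod hG _ (fun u => by
    rw [map_add, map_mul, constantCoeff_map, hform]; simp)] at h
  -- The value of `G` at `1 + e_u ℓ_u ^ q` is `(1 + ℓ_u ^ q) ^ t_u = ((1 + ℓ_u) ^ t_u) ^ q`.
  have h2 : G ^ p ^ k = (∏ u, oneAddPow (blockForm u) (t u)) ^ p ^ k := by
    rw [h, ← Finset.prod_pow]
    refine Finset.prod_congr rfl fun u _ => ?_
    rw [evalUnit_line G _ (hform u), ht u, powerSeries_subst_oneAddPow_X (hform u),
      oneAddPow_pow_char (constantCoeff_blockForm u)]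
  have : CharP (MvPowerSeries (ConjClasses Γ) F) p :=
    charP_of_injective_ringHom (C_injective (σ := ConjClasses Γ)) p
  have : ExpChar (MvPowerSeries (ConjClasses Γ) F) p := ExpChar.prime Fact.out
  exact iterateFrobenius_inj (MvPowerSeries (ConjClasses Γ) F) p k h2

/-- As `ω^u` is an algebra homomorphism, `ℓ_u` carries the group law to `s + t + s t`, and
`oneAddPow` turns that into a product. -/
theorem isMult_prod_oneAddPow (t : Block F Γ → ℤ_[p]) :
    IsMult classConst (∏ u, oneAddPow (blockForm u) (t u)) := by
  refine ⟨by simp [constantCoeff_oneAddPow], ?_⟩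
  have hl : ∀ c : ConjClasses Γ, constantCoeff
    (X (Sum.inl c) : MvPowerSeries (ConjClasses Γ ⊕ ConjClasses Γ) F) = 0 := by simp
  have hr : ∀ c : ConjClasses Γ, constantCoeff
    (X (Sum.inr c) : MvPowerSeries (ConjClasses Γ ⊕ ConjClasses Γ) F) = 0 := by simp
  have hlaw := constantCoeff_groupLaw (R := F) (classConst (Γ := Γ))
  rw [map_prod, map_prod, ← Finset.prod_mul_distrib,
    ← coe_substAlgHom (hasSubst_of_constantCoeff_zero hlaw), map_prod]
  refine Finset.prod_congr rfl fun u _ => ?_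
  rw [coe_substAlgHom, rename_eq_subst, rename_eq_subst]
  change subst (fun c => X (Sum.inl c)) _ * subst (fun c => X (Sum.inr c)) _ = _
  rw [subst_oneAddPow hl (constantCoeff_blockForm u), subst_oneAddPow hr (constantCoeff_blockForm u),
    subst_oneAddPow hlaw (constantCoeff_blockForm u), subst_blockForm hl, subst_blockForm hr,
    subst_blockForm hlaw, oneAddPow_mul (by simp) (by simp)]
  congr 1
  refine (sum_mul_conv (a := classConst) (fun c d => ?_) _ _).symm
  rw [← map_mul, ← blockHom_classSum, ← blockHom_classSum, ← map_mul, classSum_mul, map_sum,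
    map_sum]
  refine Finset.sum_congr rfl fun e _ => ?_
  rw [map_mul, map_mul, blockHom_classSum]
  exact congrArg (· * _) ((congrArg C (map_intCast _ _)).trans (map_intCast _ _))

/-- Along the line of `e_v` the form `ℓ_u` becomes `ω^u(e_v) X = δ_{uv} X`, so only the factor at
`v` survives. -/
theorem restrictLine_prod_oneAddPow (t : Block F Γ → ℤ_[p]) (v : Block F Γ) :
    restrictLine (∏ u, oneAddPow (blockForm u) (t u)) (blockIdem v) =
      oneAddPow (PowerSeries.X : PowerSeries F) (t v) := by
  have hs : ∀ c : ConjClasses Γ, constantCoeff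
    (C (classCoeff c (blockIdem v)) * X () : MvPowerSeries Unit F) = 0 := by simp
  have hform : ∀ u : Block F Γ,
      subst (fun c => (C (classCoeff c (blockIdem v)) * X () : MvPowerSeries Unit F))
        (blockForm u) = C (blockHom u (blockIdem v)) * X () := fun u => by
    rw [subst_blockForm hs]
    conv_rhs => rw [← sum_classCoeff_smul (blockIdem v), map_sum, map_sum, Finset.sum_mul]
    refine Finset.sum_congr rfl fun c _ => ?_
    rw [map_smul, blockHom_classSum, smul_eq_mul, map_mul]
    ring
  rw [restrictLine, ← coe_substAlgHom (hasSubst_of_constantCoeff_zero hs), map_prod,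
    Finset.prod_eq_single v]
  · rw [coe_substAlgHom, subst_oneAddPow hs (constantCoeff_blockForm v), hform,
      blockHom_blockIdem_self, map_one, one_mul]
    rfl
  · intro u _ huv
    rw [coe_substAlgHom, subst_oneAddPow hs (constantCoeff_blockForm u), hform,
      blockHom_blockIdem_of_ne huv, map_zero, zero_mul]
    refine EqUpTo.ext fun n => (oneAddPow_eqUpTo (map_zero _) _ n).trans ?_
    rw [Finset.sum_eq_single 0]
    · simpa [binom] using EqUpTo.refl _
    · intro r _ hr
      rw [zero_pow hr, mul_zero]
    · simp
  · simp

theorem prod_oneAddPow_injective : Function.Injective fun t : Block F Γ → ℤ_[p] =>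
    ∏ u, oneAddPow (blockForm u) (t u) := by
  intro t t' h
  funext v
  refine binom_injective (F := F) fun r => ?_
  rw [← coeff_oneAddPow_X, ← coeff_oneAddPow_X, ← restrictLine_prod_oneAddPow,
    ← restrictLine_prod_oneAddPow]
  beta_reduce at h
  rw [h]

theorem coeff_single_prod {σ R ι : Type*} [CommRing R] (S : Finset ι)
    {f : ι → MvPowerSeries σ R} (hf : ∀ i, constantCoeff (f i) = 1) (c : σ) :
    coeff (Finsupp.single c 1) (∏ i ∈ S, f i) = ∑ i ∈ S, coeff (Finsupp.single c 1) (f i) := by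
  have hmul : ∀ f g : MvPowerSeries σ R, constantCoeff f = 1 → constantCoeff g = 1 →
      coeff (Finsupp.single c 1) (f * g) =
        coeff (Finsupp.single c 1) f + coeff (Finsupp.single c 1) g := fun f g hf hg => by
    rw [coeff_mul, Finsupp.antidiagonal_single, Finset.sum_map]
    simp [Finset.Nat.antidiagonal_succ, hf, hg, add_comm]
  induction S using Finset.induction_on with
  | empty => simp [coeff_one]
  | insert i S hi ih =>
    rw [Finset.prod_insert hi, Finset.sum_insert hi, hmul _ _ (hf i) (by simp [hf]), ih]

theorem genFun_elemT {φ : RGamma Γ →+* F} {t : Block F Γ → ℤ_[p]}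
    (h : genFun φ = ∏ u, oneAddPow (blockForm u) (t u)) (c : ConjClasses Γ) :
    φ (elemT c) = ∑ u, blockCharacter u c * padicToField p F (t u) := by
  have h1 : φ (elemT c) = coeff (Finsupp.single c 1) (genFun φ) :=
    congrArg φ (Subtype.ext (coeffB_single c).symm)
  rw [h1, h, coeff_single_prod _ fun u => constantCoeff_oneAddPow _ _]
  refine Finset.sum_congr rfl fun u _ => ?_
  rw [coeff_single_oneAddPow, mul_comm, blockForm_eq, map_sum, Finset.sum_eq_single c]
  · rw [coeff_C_mul, coeff_X, if_pos rfl, mul_one]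
  · intro d _ hd
    rw [coeff_C_mul, coeff_X, if_neg, mul_zero]
    intro h
    exact hd (Finsupp.single_left_injective one_ne_zero h).symm
  · simp

end BlockFormulas

end

end WeightedIVP

theorem mainTheorem9 (Γ : Type*) [Group Γ] [Fintype Γ] (p : ℕ) [Fact p.Prime]
    (F : Type*) [Field F] [IsAlgClosed F] [CharP F p] :
    (WeightedIVP.RGamma Γ : Set (WeightedIVP.Env Γ)) = WeightedIVP.rGammaSpan Γ ∧
    ∃ Φ : (WeightedIVP.Block F Γ → ℤ_[p]) ≃ (WeightedIVP.RGamma Γ →+* F),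
      ∀ t : WeightedIVP.Block F Γ → ℤ_[p],
        (∀ c : ConjClasses Γ, Φ t (WeightedIVP.elemT c) =
          ∑ u, WeightedIVP.blockCharacter u c * WeightedIVP.padicToField p F (t u)) ∧
        WeightedIVP.genFun (Φ t) =
          ∏ u, WeightedIVP.oneAddPow (WeightedIVP.blockForm u) (t u) := by
  refine ⟨WeightedIVP.coe_RGamma, ?_⟩
  choose φ hφ using fun t : WeightedIVP.Block F Γ → ℤ_[p] =>
    WeightedIVP.exists_genFun_eq (WeightedIVP.isMult_prod_oneAddPow t)
  refine ⟨Equiv.ofBijective φ ⟨fun t t' h => ?_, fun ψ => ?_⟩, fun t =>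
    ⟨WeightedIVP.genFun_elemT (hφ t), hφ t⟩⟩
  · refine WeightedIVP.prod_oneAddPow_injective ?_
    beta_reduce
    rw [← hφ, ← hφ, h]
  · obtain ⟨t, ht⟩ := (WeightedIVP.isMult_genFun ψ).exists_eq_prod_oneAddPow (p := p)
    exact ⟨t, WeightedIVP.genFun_injective ((hφ t).trans ht.symm)⟩
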